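/- **Theorem.** There exists a reflexive, hereditarily indecomposable real Banach space $\mathfrak{X}_{HI}$ which admits neither $\ell_p$, for any $1\le p<\infty$, nor $c_0$ as a spreading model. Here a Banach space $X$ is *hereditarily indecomposable* if it is infinite-dimensional and no closed subspace of $X$ is the topological direct sum of two infinite-dimensional closed subspaces. Let $E$ be $\ell_p$ $(1\le p<\infty)$ or $c_0$, with unit vector basis $(e_i)_{i\ge 1}$. The space $X$ *admits $E$ as a spreading model* if there are a normalized basic sequence $(x_i)_{i\ge1}$ in $X$ and a constant $C\ge1$ such that, for every finite $F\subset\{1,2,\dots\}$ with $\#F\le\min F$ and all real scalars $(a_i)_{i\in F}$, $$C^{-1}\Big\|\sum_{i\in F}a_ie_i\Big\|_{E}\le\Big\|\sum_{i\in F}a_ix_i\Big\|\le C\Big\|\sum_{i\in F}a_ie_i\Big\|_{E}.$$ -/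

import Mathlib

namespace SpreadingModels

/-- A Banach space is reflexive if the canonical embedding into its double dual is onto. -/
def IsReflexiveSpace (X : Type*) [NormedAddCommGroup X] [NormedSpace ℝ X] : Prop :=
  Function.Surjective (NormedSpace.inclusionInDoubleDual ℝ X)

/-- A normed space is decomposable if it is the topological direct sum of two infinite-dimensional
subspaces. -/
def IsDecomposable (Y : Type*) [NormedAddCommGroup Y] [NormedSpace ℝ Y] : Prop :=
  ∃ P Q : Submodule ℝ Y, ¬ FiniteDimensional ℝ P ∧ ¬ FiniteDimensional ℝ Q ∧
    Submodule.IsTopCompl P Q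

/-- Hereditarily indecomposable: infinite-dimensional, and no closed subspace is decomposable. -/
def IsHereditarilyIndecomposable (X : Type*) [NormedAddCommGroup X] [NormedSpace ℝ X] : Prop :=
  ¬ FiniteDimensional ℝ X ∧
    ∀ Y : Submodule ℝ X, IsClosed (Y : Set X) → ¬ IsDecomposable Y

/-- A basic sequence: a Schauder basis of its closed linear span. -/
def IsBasicSequence {X : Type*} [NormedAddCommGroup X] [NormedSpace ℝ X] (x : ℕ → X) : Prop :=
  ∃ b : SchauderBasis ℝ (Submodule.span ℝ (Set.range x)).topologicalClosure,
    ∀ n, (b n : X) = x n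

/-- The Schreier family `S₁` of all finite sets `F` with `#F ≤ min F`, for sequences listed as
`x₁, x₂, …`. As Lean lists a sequence from index `0`, the index `i` has position `i + 1`. -/
def IsSchreier (F : Finset ℕ) : Prop :=
  ∀ i ∈ F, F.card ≤ i + 1

/-- The norm of `∑ i ∈ F, a i • e i` in `ℓ_p`, for `1 ≤ p < ∞`. -/
noncomputable def lpNormOn (p : ℝ) (F : Finset ℕ) (a : ℕ → ℝ) : ℝ :=
  (∑ i ∈ F, |a i| ^ p) ^ (1 / p)

/-- The norm of `∑ i ∈ F, a i • e i` in `c₀`, that is `max {|a i| : i ∈ F}` (`0` if `F` is empty;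
the norm on the right is Mathlib's sup norm on a finite product). -/
noncomputable def c0NormOn (F : Finset ℕ) (a : ℕ → ℝ) : ℝ :=
  ‖fun i : F => a i‖

/-- `(x i)` is a normalized basic sequence and there is `C ≥ 1` such that for each Schreier set `F`
the family `(x i)`, `i ∈ F`, is `C`-equivalent to the unit vectors `(e i)`, `i ∈ F`, where `N F a`
is the norm of `∑ i ∈ F, a i • e i`. -/
def GeneratesSpreadingModel {X : Type*} [NormedAddCommGroup X] [NormedSpace ℝ X]
    (N : Finset ℕ → (ℕ → ℝ) → ℝ) (x : ℕ → X) : Prop :=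
  (∀ n, ‖x n‖ = 1) ∧ IsBasicSequence x ∧
    ∃ C : ℝ, 1 ≤ C ∧ ∀ F : Finset ℕ, IsSchreier F → ∀ a : ℕ → ℝ,
      C⁻¹ * N F a ≤ ‖∑ i ∈ F, a i • x i‖ ∧ ‖∑ i ∈ F, a i • x i‖ ≤ C * N F a

/-- `X` admits `ℓ_p` as a spreading model. -/
def AdmitsLpSpreadingModel (X : Type*) [NormedAddCommGroup X] [NormedSpace ℝ X] (p : ℝ) : Prop :=
  ∃ x : ℕ → X, GeneratesSpreadingModel (lpNormOn p) x

/-- `X` admits `c₀` as a spreading model. -/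
def AdmitsC0SpreadingModel (X : Type*) [NormedAddCommGroup X] [NormedSpace ℝ X] : Prop :=
  ∃ x : ℕ → X, GeneratesSpreadingModel c0NormOn x

end SpreadingModels

/-! The norm is a supremum over a norming set of finitely supported functionals, in the spirit of
Gowers and Maurey: a functional of weight k is 1/m_k times a sum of n_k successive functionals. Two
rules decide everything. Functionals of different weights are combined only with coefficients in the
ℓ₂ ball, and for odd weights the summands form a special sequence, the weight of each one coding its
predecessors.

For p > 1, ℓ_p and also c₀ fail because sums are too large: even weights give sums of n_k blocks a
norm of order at least n_k/m_k, and n_k outgrows every fixed power of m_k (`lower_estimate`,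
`no_upper_power`). For ℓ₁ sums are too small. By the ℓ₂ rule the norms of a vector over the single
weights are square summable, so after passing to a subsequence a bounded block sequence lives, up to
finitely many weights and small errors, on disjoint sets of weights (`exists_disjoint_weights`).
Cauchy–Schwarz bounds the large weights on N blocks by εN + C√N, while the finitely many small
weights have bounded length and gain a factor 1/2 at each level of the tree of a functional
(`tree_estimate`). So some Schreier sum has norm below δ times its length
(`exists_small_schreier_sum`). General sequences are reduced to blocks by taking differences.

Reflexivity: the space contains every sequence on which the norming set is bounded, and its basis is
shrinking, since otherwise some blocks would have a lower ℓ₁ estimate.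

Indecomposability: up to a perturbation, two infinite-dimensional subspaces contain alternately the
vectors of a dependent sequence of odd weight q. Its own functionals make the plain sum at least
n_q/m_q. Any other special functional agrees with them up to some index and afterwards, by
injectivity of the coding, meets wrong weights with at most one exception; hence special functionals
are bounded on the alternating sum, whose norm is at most 162 n_q/m_q². The two subspaces are thus
at angle zero. -/

namespace HISpace

open Finset

/-! ### Weights and lengths. -/

/-- The weights `m_k` of the norming set. -/
def wt (k : ℕ) : ℕ := 2 ^ 2 ^ (k + 2)

/-- Square roots of the lengths `n_k`. -/
def root : ℕ → ℕ
  | 0 => wt 0 ^ 4 * 2 ^ 2 ^ 4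
  | k + 1 => wt (k + 1) ^ (k + 5) * (root k ^ 2 + 2) ^ 2 ^ (k + 5)

/-- The lengths `n_k`: a functional of weight `k` is `1 / m_k` times a sum of `n_k` functionals. -/
def len (k : ℕ) : ℕ := root k ^ 2

/-- An upper bound for all lengths `n_i`, `i < k`. -/
def prevLen : ℕ → ℕ
  | 0 => 0
  | k + 1 => len k

theorem wt_succ (k : ℕ) : wt (k + 1) = wt k ^ 2 := by
  unfold wt; rw [← pow_mul, ← pow_succ]

theorem sixteen_le_wt (k : ℕ) : 16 ≤ wt k := by
  have : 2 ^ 2 ≤ 2 ^ (k + 2) := Nat.pow_le_pow_right (by norm_num) (by omega)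
  calc 16 = 2 ^ 4 := by norm_num
    _ ≤ wt k := Nat.pow_le_pow_right (by norm_num) this

theorem wt_pos (k : ℕ) : 0 < wt k := by have := sixteen_le_wt k; omega

theorem wt_strictMono : StrictMono wt := by
  refine strictMono_nat_of_lt_succ fun k => ?_
  rw [wt_succ]; have := sixteen_le_wt k; nlinarith

theorem le_wt (k : ℕ) : k ≤ wt k := wt_strictMono.le_apply

/-- The two factors have separate tasks: the first makes the length exceed any fixed power of the
weight, the second absorbs the factors (n + 2)^d produced by d levels of the tree estimate. -/
theorem root_eq (k : ℕ) : root k = wt k ^ (k + 4) * (prevLen k + 2) ^ 2 ^ (k + 4) := by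
  cases k <;> rfl

theorem root_pos (k : ℕ) : 0 < root k := by
  rw [root_eq]; have := wt_pos k; positivity

theorem len_pos (k : ℕ) : 0 < len k := pow_pos (root_pos k) 2

theorem root_le_len (k : ℕ) : root k ≤ len k := by
  have := root_pos k; unfold len; nlinarith

theorem len_le_succ (k : ℕ) : len k ≤ len (k + 1) := by
  refine le_trans ?_ (root_le_len _)
  rw [root_eq]
  have h1 : 1 ≤ wt (k + 1) ^ (k + 1 + 4) := Nat.one_le_pow _ _ (wt_pos _)
  have h2 : len k + 2 ≤ (prevLen (k + 1) + 2) ^ 2 ^ (k + 1 + 4) :=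
    Nat.le_self_pow (by positivity) _
  nlinarith

theorem len_mono : Monotone len := monotone_nat_of_le_succ len_le_succ

theorem len_le_prevLen {k K : ℕ} (h : k < K) : len k ≤ prevLen K := by
  obtain ⟨K, rfl⟩ : ∃ j, K = j + 1 := ⟨K - 1, by omega⟩
  exact len_mono (by omega)

theorem wt_pow_le_root (k : ℕ) : wt k ^ (k + 4) ≤ root k := by
  rw [root_eq]; exact Nat.le_mul_of_pos_right _ (by positivity)

theorem wt_le_root (k : ℕ) : wt k ≤ root k :=
  (Nat.le_self_pow (by omega) _).trans (wt_pow_le_root k)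

theorem le_len (k : ℕ) : k ≤ len k := (le_wt k).trans ((wt_le_root k).trans (root_le_len k))

/-- The slack that makes all error terms of the tree estimates small. -/
theorem wt_mul_le_root (k : ℕ) :
    wt k ^ 4 * (prevLen k + 2) ^ 2 ^ (k + 4) ≤ root k := by
  rw [root_eq]
  exact Nat.mul_le_mul_right _ (Nat.pow_le_pow_right (wt_pos k) (by omega))

/-- Weights are squared at each step, so 1/m_k ≤ 2/m_k - 2/m_{k+1} and the sum telescopes. -/
theorem sum_inv_wt_le {K : ℕ} {s : Finset ℕ} (hs : ∀ k ∈ s, K ≤ k) :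
    ∑ k ∈ s, (wt k : ℝ)⁻¹ ≤ 2 / wt K := by
  have hpos : ∀ k, (0 : ℝ) < wt k := fun k => by exact_mod_cast wt_pos k
  have key : ∀ d, ∑ k ∈ Ico K (K + d), (wt k : ℝ)⁻¹ ≤ 2 / wt K - 2 / wt (K + d) := by
    intro d
    induction d with
    | zero => simp
    | succ d ih =>
      rw [← add_assoc, sum_Ico_succ_top (by omega)]
      have h1 : (2 : ℝ) / wt (K + d + 1) ≤ (wt (K + d) : ℝ)⁻¹ := by
        have : (16 : ℝ) ≤ wt (K + d) := by exact_mod_cast sixteen_le_wt _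
        rw [wt_succ, Nat.cast_pow, div_le_iff₀ (by positivity)]
        rw [sq, ← mul_assoc, inv_mul_cancel₀ (hpos _).ne']; linarith
      have h2 : (2 : ℝ) / wt (K + d) = (wt (K + d) : ℝ)⁻¹ + (wt (K + d) : ℝ)⁻¹ := by
        rw [div_eq_mul_inv]; ring
      linarith
  have hsub : s ⊆ Ico K (K + (s.sup id + 1)) := fun k hk => by
    have : k ≤ s.sup id := le_sup (f := id) hk
    simp only [mem_Ico]; exact ⟨hs k hk, by omega⟩
  calc _ ≤ _ := sum_le_sum_of_subset_of_nonneg hsub fun k _ _ => by positivity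
    _ ≤ _ := key _
    _ ≤ _ := sub_le_self _ (by have := hpos (K + (s.sup id + 1)); positivity)

theorem sum_inv_wt_le_half (s : Finset ℕ) : ∑ k ∈ s, (wt k : ℝ)⁻¹ ≤ 1 / 2 := by
  refine (sum_inv_wt_le (K := 0) fun k _ => Nat.zero_le k).trans ?_
  have : (16 : ℝ) ≤ wt 0 := by exact_mod_cast sixteen_le_wt 0
  rw [div_le_div_iff₀ (by linarith) (by norm_num)]; linarith

/-! ### The norming set. -/

/-- Finitely supported rational functionals on sequences. -/
abbrev Fn := ℕ →₀ ℚ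

/-- The functional `f` is supported in the interval `[a, b)`. -/
def SuppIn (f : Fn) (a b : ℕ) : Prop := ∀ n, f n ≠ 0 → a ≤ n ∧ n < b

/-- The restriction of `f` to the interval `[a, b)`. -/
def cut (a b : ℕ) : Fn →ₗ[ℚ] Fn where
  toFun f := f.filter fun n => a ≤ n ∧ n < b
  map_add' _ _ := Finsupp.filter_add
  map_smul' _ _ := Finsupp.filter_smul

theorem cut_apply (a b : ℕ) (f : Fn) (n : ℕ) :
    cut a b f n = if a ≤ n ∧ n < b then f n else 0 := rfl

theorem suppIn_cut (a b : ℕ) (f : Fn) : SuppIn (cut a b f) a b := fun n hn => by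
  rw [cut_apply] at hn; by_contra h; rw [if_neg h] at hn; exact hn rfl

theorem SuppIn.cut {f : Fn} {a b : ℕ} (h : SuppIn f a b) (c d : ℕ) :
    SuppIn (cut c d f) a b := fun n hn => by
  rw [cut_apply] at hn
  split_ifs at hn
  · exact h n hn
  · exact absurd rfl hn

theorem SuppIn.cut_eq {f : Fn} {a b : ℕ} (h : SuppIn f a b) : HISpace.cut a b f = f := by
  ext n
  rw [cut_apply]
  split_ifs with hn
  · rfl
  · by_contra h0; exact hn (h n fun h' => h0 h'.symm)

theorem SuppIn.mono {f : Fn} {a b c d : ℕ} (h : SuppIn f a b) (hca : c ≤ a) (hbd : b ≤ d) :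
    SuppIn f c d := fun n hn => ⟨hca.trans (h n hn).1, (h n hn).2.trans_le hbd⟩

theorem suppIn_zero (a b : ℕ) : SuppIn 0 a b := fun n hn => by simp at hn

theorem exists_suppIn (f : Fn) : ∃ b, SuppIn f 0 b :=
  ⟨f.support.sup id + 1, fun n hn => ⟨Nat.zero_le n,
    Nat.lt_succ_of_le (Finset.le_sup (f := id) (Finsupp.mem_support_iff.2 hn))⟩⟩

theorem cut_cut (a b c d : ℕ) (f : Fn) : cut a b (cut c d f) = cut (max a c) (min b d) f := by
  ext n; simp only [cut_apply]
  split_ifs <;> first | rfl | omega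

/-- An injective coding of finite sequences of functionals. -/
noncomputable def listCode : List Fn → ℕ := (exists_injective_nat (List Fn)).choose

theorem listCode_injective : Function.Injective listCode :=
  (exists_injective_nat (List Fn)).choose_spec

/-- The weight prescribed for the next member of a special sequence of length `n_q`. -/
noncomputable def code (q : ℕ) (l : List Fn) : ℕ := 2 * (len q ^ 2 + listCode l)

/-- Special sequences use even weights only, because exact pairs are constructed for even weights.
-/
theorem code_even (q : ℕ) (l : List Fn) : Even (code q l) := even_two_mul _

theorem code_injective (q : ℕ) : Function.Injective (code q) := fun l l' h =>
  listCode_injective (by unfold code at h; omega)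

/-- This makes each of the n_q² mismatched terms in `IsDependent.abs_special_le` of order 1/n_q². -/
theorem len_sq_le_wt_code (q : ℕ) (l : List Fn) : len q ^ 2 ≤ wt (code q l) :=
  le_trans (by unfold code; omega) (le_wt _)

theorem lt_code (q : ℕ) (l : List Fn) : q < code q l := by
  have h1 := len_pos q
  have h2 := le_len q
  unfold code; nlinarith

/-- The norming set. `Norming none f` says that `f` belongs to the norming set, and
`Norming (some k) f` that `f` is a functional of weight `k`. -/
inductive Norming : Option ℕ → Fn → Prop
  | unit (n : ℕ) (c : ℚ) (hc : |c| ≤ 1) : Norming none (Finsupp.single n c)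
  -- The index is the weight, so each weight occurs at most once in a combination.
  | comb (s : Finset ℕ) (c : ℕ → ℚ) (g : ℕ → Fn) (hc : ∑ k ∈ s, c k ^ 2 ≤ 1)
      (hg : ∀ k ∈ s, Norming (some k) (g k)) : Norming none (∑ k ∈ s, c k • g k)
  | even (k : ℕ) (hk : Even k) (f : ℕ → Fn) (r : ℕ → ℕ) (hr : Monotone r)
      (hs : ∀ t, SuppIn (f t) (r t) (r (t + 1))) (hf : ∀ t, Norming none (f t)) :
      Norming (some k) ((wt k : ℚ)⁻¹ • ∑ t ∈ range (len k), f t)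
  -- The coding refers to the uncut functionals; the interval enters only in the sum, so that
  -- restrictions remain in the norming set.
  | odd (q : ℕ) (hq : Odd q) (f : ℕ → Fn) (r : ℕ → ℕ) (hr : Monotone r)
      (hs : ∀ t, SuppIn (f t) (r t) (r (t + 1)))
      (hf : ∀ t, Norming (some (code q ((List.range t).map f))) (f t)) (a b : ℕ) :
      Norming (some q) ((wt q : ℚ)⁻¹ • ∑ t ∈ range (len q), cut a b (f t))

theorem Norming.zero : Norming none 0 := by
  simpa using Norming.comb ∅ 0 0 (by simp) (by simp)

theorem Norming.of_weight {k : ℕ} {g : Fn} (h : Norming (some k) g) : Norming none g := by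
  simpa using Norming.comb {k} 1 (fun _ => g) (by simp) (by simpa using h)

/-- This closure property makes interval projections contractions; it also preserves weights. -/
theorem Norming.cut {o : Option ℕ} {f : Fn} (h : Norming o f) (a b : ℕ) :
    Norming o (HISpace.cut a b f) := by
  induction h with
  | unit n c hc =>
    by_cases hn : a ≤ n ∧ n < b
    · have : HISpace.cut a b (Finsupp.single n c) = Finsupp.single n c :=
        Finsupp.filter_single_of_pos _ hn
      rw [this]; exact .unit n c hc
    · have : HISpace.cut a b (Finsupp.single n c) = 0 := Finsupp.filter_single_of_neg _ hn
      rw [this]; exact .zero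
  | comb s c g hc hg ih =>
    simp only [map_sum, map_smul]
    exact .comb s c _ hc ih
  | even k hk f r hr hs hf ih =>
    simp only [map_sum, map_smul]
    exact .even k hk _ r hr (fun t => (hs t).cut a b) ih
  | odd q hq f r hr hs hf c d ih =>
    simp only [map_sum, map_smul, cut_cut]
    exact .odd q hq f r hr hs hf _ _

theorem Norming.neg {f : Fn} (h : Norming none f) : Norming none (-f) := by
  cases h with
  | unit n c hc =>
    rw [← Finsupp.single_neg]
    exact .unit n (-c) (by rwa [abs_neg])
  | comb s c g hc hg =>
    have := Norming.comb s (-c) g (by simpa using hc) hg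
    simpa using this

/-- Every functional of weight `k` is `1 / m_k` times a sum of `n_k` successive functionals. -/
theorem Norming.decomp {k : ℕ} {g : Fn} (h : Norming (some k) g) {a b : ℕ} (hab : a ≤ b)
    (hg : SuppIn g a b) :
    ∃ (f : ℕ → Fn) (r : ℕ → ℕ), Monotone r ∧ (∀ t, a ≤ r t ∧ r t ≤ b) ∧
      (∀ t, SuppIn (f t) (r t) (r (t + 1))) ∧ (∀ t, Norming none (f t)) ∧
      g = (wt k : ℚ)⁻¹ • ∑ t ∈ range (len k), f t := by
  have key : ∃ (f : ℕ → Fn) (r : ℕ → ℕ), Monotone r ∧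
      (∀ t, SuppIn (f t) (r t) (r (t + 1))) ∧ (∀ t, Norming none (f t)) ∧
      g = (wt k : ℚ)⁻¹ • ∑ t ∈ range (len k), f t := by
    cases h with
    | even _ hk f r hr hs hf => exact ⟨f, r, hr, hs, hf, rfl⟩
    | odd _ hq f r hr hs hf c d =>
      exact ⟨_, r, hr, fun t => (hs t).cut c d, fun t => (hf t).of_weight.cut c d, rfl⟩
  obtain ⟨f, r, hr, hs, hf, rfl⟩ := key
  refine ⟨fun t => HISpace.cut a b (f t), fun t => max a (min b (r t)), fun i j hij => ?_,
    fun t => by dsimp only; omega, fun t n hn => ?_, fun t => (hf t).cut a b, ?_⟩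
  · have := hr hij; dsimp only; omega
  · have h1 := suppIn_cut a b (f t) n hn
    have h2 := (hs t).cut a b n hn
    dsimp only; omega
  · rw [← hg.cut_eq, map_smul, map_sum]

/-- Even weights admit arbitrary successive sums of length at most `n_k`. -/
theorem Norming.even_of_le {k : ℕ} (hk : Even k) {N : ℕ} (hN : N ≤ len k) {f : ℕ → Fn} {r : ℕ → ℕ}
    (hr : Monotone r) (hs : ∀ t < N, SuppIn (f t) (r t) (r (t + 1)))
    (hf : ∀ t < N, Norming none (f t)) :
    Norming (some k) ((wt k : ℚ)⁻¹ • ∑ t ∈ range N, f t) := by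
  have := Norming.even k hk (fun t => if t < N then f t else 0) r hr
    (fun t => by split_ifs with h; exacts [hs t h, suppIn_zero _ _])
    (fun t => by split_ifs with h; exacts [hf t h, .zero])
  convert this using 2
  rw [← sum_filter]
  refine sum_congr ?_ fun _ _ => rfl
  ext t; simp; omega

theorem Norming.zero_of_even {k : ℕ} (hk : Even k) : Norming (some k) 0 := by
  simpa using Norming.even_of_le hk (Nat.zero_le _) (f := 0) (r := 0) monotone_const (by simp)
    (by simp)

/-- At a given coordinate at most one of the successive summands is nonzero, so only the factor
1/m_k remains; combinations are then controlled by the sum of all 1/m_k. -/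
theorem Norming.abs_apply_le {o : Option ℕ} {f : Fn} (h : Norming o f) (n : ℕ) :
    |(f n : ℝ)| ≤ o.elim 1 fun k => (wt k : ℝ)⁻¹ := by
  have succ : ∀ (k : ℕ) (f : ℕ → Fn) (r : ℕ → ℕ), Monotone r →
      (∀ t, SuppIn (f t) (r t) (r (t + 1))) → (∀ t, |(f t n : ℝ)| ≤ 1) →
      |((((wt k : ℚ)⁻¹ • ∑ t ∈ range (len k), f t) n : ℚ) : ℝ)| ≤ (wt k : ℝ)⁻¹ := by
    intro k f r hr hs hf
    have hone : |∑ t ∈ range (len k), (f t n : ℝ)| ≤ 1 := by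
      by_cases hex : ∃ t ∈ range (len k), f t n ≠ 0
      · obtain ⟨t, ht, hne⟩ := hex
        rw [sum_eq_single_of_mem t ht fun u _ hu => ?_]
        · exact hf t
        · by_contra h0
          have h1 := hs t n hne
          have h2 := hs u n (by exact_mod_cast h0)
          rcases lt_or_gt_of_ne hu with h | h
          · have := hr (show u + 1 ≤ t by omega); omega
          · have := hr (show t + 1 ≤ u by omega); omega
      · push Not at hex
        rw [sum_eq_zero fun t ht => by rw [hex t ht]; simp]; simp
    have : (0 : ℝ) ≤ (wt k : ℝ)⁻¹ := by positivity
    simp only [Finsupp.smul_apply, Finsupp.finsetSum_apply, smul_eq_mul]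
    push_cast
    rw [abs_mul, abs_of_nonneg this]
    nlinarith
  induction h with
  | unit m c hc =>
    simp only [Finsupp.single_apply, Option.elim]
    split_ifs
    · exact_mod_cast hc
    · simp
  | comb s c g hc hg ih =>
    simp only [Finsupp.finsetSum_apply, Finsupp.smul_apply, smul_eq_mul, Option.elim]
    push_cast
    calc _ ≤ ∑ k ∈ s, |(c k : ℝ) * (g k n : ℝ)| := abs_sum_le_sum_abs _ _
      _ ≤ ∑ k ∈ s, (wt k : ℝ)⁻¹ := sum_le_sum fun k hk => by
        have h1 : |(c k : ℝ)| ≤ 1 := by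
          have : c k ^ 2 ≤ 1 := (single_le_sum (fun i _ => sq_nonneg (c i)) hk).trans hc
          rw [← sq_le_one_iff_abs_le_one]; exact_mod_cast this
        have h2 := ih k hk
        simp only [Option.elim] at h2
        rw [abs_mul]
        nlinarith [abs_nonneg (c k : ℝ), abs_nonneg (g k n : ℝ)]
      _ ≤ 1 := (sum_inv_wt_le_half s).trans (by norm_num)
  | even k hk f r hr hs hf ih => exact succ k f r hr hs ih
  | odd q hq f r hr hs hf a b ih =>
    refine succ q _ r hr (fun t => (hs t).cut a b) fun t => ?_
    rw [cut_apply]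
    have h1 := ih t
    simp only [Option.elim] at h1
    have h2 : (wt (code q ((List.range t).map f)) : ℝ)⁻¹ ≤ 1 :=
      inv_le_one_of_one_le₀ (by exact_mod_cast wt_pos _)
    split_ifs
    · linarith
    · simp

/-! ### The Banach space, its coordinates and its interval projections. -/

/-- The functionals of the norming set. -/
abbrev NormSet := {f : Fn // Norming none f}

/-- The `n`-th coordinate functional. -/
noncomputable def unitFn (n : ℕ) : NormSet := ⟨Finsupp.single n 1, .unit n 1 (by simp)⟩

/-- The value of the functional `f` at the sequence `v`. -/
noncomputable def pair (v : ℕ → ℝ) : Fn →ₗ[ℚ] ℝ := Finsupp.linearCombination ℚ v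

theorem pair_apply (v : ℕ → ℝ) (f : Fn) : pair v f = ∑ n ∈ f.support, (f n : ℝ) * v n := by
  simp [pair, Finsupp.linearCombination_apply, Finsupp.sum, Rat.smul_def]

theorem pair_single (v : ℕ → ℝ) (n : ℕ) (c : ℚ) : pair v (Finsupp.single n c) = c * v n := by
  simp [pair, Rat.smul_def]

/-- The space of all sequences on which the norming set is bounded, with the supremum norm over
the norming set. -/
noncomputable def space : Submodule ℝ (lp (fun _ : NormSet => ℝ) ⊤) where
  -- Elements are bounded functions on the norming set that are determined by their coordinates, so
  -- completeness reduces to closedness of these equations.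
  carrier := {φ | ∀ f : NormSet, φ f = pair (fun n => φ (unitFn n)) f}
  add_mem' {φ ψ} hφ hψ f := by
    simp only [lp.coeFn_add, Pi.add_apply, pair_apply, mul_add, sum_add_distrib] at *
    rw [hφ, hψ]
  zero_mem' f := by simp [pair_apply]
  smul_mem' c φ hφ f := by
    simp only [lp.coeFn_smul, Pi.smul_apply, smul_eq_mul, pair_apply, Set.mem_ofPred_eq] at *
    rw [hφ, mul_sum]
    exact sum_congr rfl fun n _ => by ring

/-- The Banach space under consideration. -/
def X : Type := space

noncomputable instance : NormedAddCommGroup X := inferInstanceAs (NormedAddCommGroup space)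
noncomputable instance : NormedSpace ℝ X := inferInstanceAs (NormedSpace ℝ space)

theorem isClosed_space : IsClosed (space : Set (lp (fun _ : NormSet => ℝ) ⊤)) := by
  have hcont : ∀ f : NormSet, Continuous fun φ : lp (fun _ : NormSet => ℝ) ⊤ => φ f := fun f =>
    (LipschitzWith.of_dist_le_mul (K := 1) fun φ ψ => by
      rw [dist_eq_norm, dist_eq_norm, NNReal.coe_one, one_mul]
      simpa using lp.norm_apply_le_norm (by simp) (φ - ψ) f).continuous
  have : (space : Set (lp (fun _ : NormSet => ℝ) ⊤)) =
      ⋂ f : NormSet, {φ | φ f = pair (fun n => φ (unitFn n)) f} := by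
    ext φ; simp [space]
  rw [this]
  refine isClosed_iInter fun f => isClosed_eq (hcont f) ?_
  simp only [pair_apply]
  exact continuous_finsetSum _ fun n _ => continuous_const.mul (hcont _)

instance : CompleteSpace X :=
  (isClosed_space.completeSpace_coe : CompleteSpace space)

/-- The coordinates of a vector. -/
noncomputable def coord (x : X) (n : ℕ) : ℝ := x.1 (unitFn n)

/-- The value of the functional `f` at the vector `x`. -/
noncomputable def ev (f : Fn) (x : X) : ℝ := pair (coord x) f

theorem coe_apply (x : X) (f : NormSet) : x.1 f = ev f x := x.2 f

theorem coord_add (x y : X) (n : ℕ) : coord (x + y) n = coord x n + coord y n := rfl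
theorem coord_sub (x y : X) (n : ℕ) : coord (x - y) n = coord x n - coord y n := rfl
theorem coord_smul (c : ℝ) (x : X) (n : ℕ) : coord (c • x) n = c * coord x n := rfl
theorem coord_zero (n : ℕ) : coord 0 n = 0 := rfl

theorem ev_add (f : Fn) (x y : X) : ev f (x + y) = ev f x + ev f y := by
  simp only [ev, pair_apply, coord_add, mul_add, sum_add_distrib]

theorem ev_smul (f : Fn) (c : ℝ) (x : X) : ev f (c • x) = c * ev f x := by
  simp only [ev, pair_apply, coord_smul, mul_sum]
  exact sum_congr rfl fun n _ => by ring

/-- Evaluation at a functional, as a linear map. -/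
noncomputable def evL (f : Fn) : X →ₗ[ℝ] ℝ where
  toFun := ev f
  map_add' := ev_add f
  map_smul' := ev_smul f

theorem ev_sum {ι : Type*} (f : Fn) (s : Finset ι) (x : ι → X) :
    ev f (∑ i ∈ s, x i) = ∑ i ∈ s, ev f (x i) := map_sum (evL f) x s

theorem ev_sub (f : Fn) (x y : X) : ev f (x - y) = ev f x - ev f y := map_sub (evL f) x y

theorem ev_zero (f : Fn) : ev f 0 = 0 := map_zero (evL f)

theorem sum_ev {ι : Type*} (s : Finset ι) (f : ι → Fn) (x : X) :
    ev (∑ i ∈ s, f i) x = ∑ i ∈ s, ev (f i) x := map_sum (pair (coord x)) f s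

theorem smul_ev (c : ℚ) (f : Fn) (x : X) : ev (c • f) x = c * ev f x := by
  simp [ev, map_smul, Rat.smul_def]

theorem neg_ev (f : Fn) (x : X) : ev (-f) x = -ev f x := map_neg (pair (coord x)) f

theorem ev_single (n : ℕ) (c : ℚ) (x : X) : ev (Finsupp.single n c) x = c * coord x n :=
  pair_single _ _ _

theorem ev_congr {f : Fn} {x y : X} (h : ∀ n, f n ≠ 0 → coord x n = coord y n) :
    ev f x = ev f y := by
  simp only [ev, pair_apply]
  exact sum_congr rfl fun n hn => by rw [h n (Finsupp.mem_support_iff.1 hn)]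

theorem abs_ev_le_norm {f : Fn} (hf : Norming none f) (x : X) : |ev f x| ≤ ‖x‖ := by
  have := lp.norm_apply_le_norm (p := ⊤) (by simp) x.1 ⟨f, hf⟩
  rwa [coe_apply, Real.norm_eq_abs] at this

theorem norm_le_of_forall {x : X} {C : ℝ} (hC : 0 ≤ C) (h : ∀ f, Norming none f → |ev f x| ≤ C) :
    ‖x‖ ≤ C := by
  refine lp.norm_le_of_forall_le (f := x.1) hC fun f => ?_
  rw [coe_apply, Real.norm_eq_abs]
  exact h f f.2

theorem exists_lt_ev {x : X} {c : ℝ} (hc : 0 ≤ c) (h : c < ‖x‖) :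
    ∃ f, Norming none f ∧ c < ev f x := by
  by_contra! hcon
  refine absurd (norm_le_of_forall hc fun f hf => abs_le'.2 ⟨hcon f hf, ?_⟩) (not_le.2 h)
  rw [← neg_ev]; exact hcon _ hf.neg

theorem coord_eq_ev (x : X) (n : ℕ) : coord x n = ev (Finsupp.single n 1) x := by
  simp [ev_single]

theorem abs_coord_le (x : X) (n : ℕ) : |coord x n| ≤ ‖x‖ := by
  rw [coord_eq_ev]; exact abs_ev_le_norm (unitFn n).2 x

theorem coord_sum {ι : Type*} (s : Finset ι) (x : ι → X) (n : ℕ) :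
    coord (∑ i ∈ s, x i) n = ∑ i ∈ s, coord (x i) n := by
  simp only [coord_eq_ev, ev_sum]

/-- The coordinate functionals. -/
noncomputable def coordL (n : ℕ) : StrongDual ℝ X :=
  (evL (Finsupp.single n 1)).mkContinuous 1 fun x => by
    rw [one_mul]; exact abs_ev_le_norm (unitFn n).2 x

theorem coordL_apply (n : ℕ) (x : X) : coordL n x = coord x n := (coord_eq_ev x n).symm

theorem ext_coord {x y : X} (h : ∀ n, coord x n = coord y n) : x = y := by
  refine Subtype.ext (lp.ext (funext fun f => ?_))
  rw [coe_apply, coe_apply]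
  exact ev_congr fun n _ => h n

/-- Every sequence on which the norming set is bounded is in the space. -/
theorem exists_coord_eq {v : ℕ → ℝ} {C : ℝ} (h : ∀ f, Norming none f → |pair v f| ≤ C) :
    ∃ x : X, ∀ n, coord x n = v n := by
  have hmem : Memℓp (fun f : NormSet => pair v f) ⊤ := memℓp_infty
    ⟨C, by rintro _ ⟨f, rfl⟩; exact h f f.2⟩
  have hv : ∀ n, pair v (unitFn n) = v n := fun n => by simp [unitFn, pair_single]
  refine ⟨⟨⟨_, hmem⟩, fun f => ?_⟩, hv⟩
  change pair v f = pair (fun n => pair v (unitFn n)) f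
  simp only [hv]

theorem pair_indicator (v : ℕ → ℝ) (a b : ℕ) (f : Fn) :
    pair ((Set.Ico a b).indicator v) f = pair v (cut a b f) := by
  rw [pair_apply, pair_apply]
  have hsub : (cut a b f).support ⊆ f.support := Finset.filter_subset _ _
  rw [← sum_subset hsub fun n _ hn => ?_]
  · refine sum_congr rfl fun n hn => ?_
    have := suppIn_cut a b f n (Finsupp.mem_support_iff.1 hn)
    rw [Set.indicator_of_mem (by exact this), cut_apply, if_pos this]
  · by_cases h : a ≤ n ∧ n < b
    · rw [Finsupp.notMem_support_iff, cut_apply, if_pos h] at hn; simp [hn]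
    · rw [Set.indicator_of_notMem (by exact h), mul_zero]

theorem exists_trunc (x : X) (a b : ℕ) :
    ∃ z : X, ∀ n, coord z n = (Set.Ico a b).indicator (coord x) n :=
  exists_coord_eq (C := ‖x‖) fun f hf => by
    rw [pair_indicator]; exact abs_ev_le_norm (hf.cut a b) x

/-- The restriction of a vector to the interval `[a, b)`. -/
noncomputable def trunc (a b : ℕ) (x : X) : X := (exists_trunc x a b).choose

theorem coord_trunc (a b : ℕ) (x : X) (n : ℕ) :
    coord (trunc a b x) n = if a ≤ n ∧ n < b then coord x n else 0 := by
  rw [trunc, (exists_trunc x a b).choose_spec, Set.indicator_apply]; rfl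

theorem ev_trunc (a b : ℕ) (f : Fn) (x : X) : ev f (trunc a b x) = ev (cut a b f) x := by
  have : coord (trunc a b x) = (Set.Ico a b).indicator (coord x) :=
    funext (exists_trunc x a b).choose_spec
  rw [ev, this, pair_indicator]; rfl

theorem norm_trunc_le (a b : ℕ) (x : X) : ‖trunc a b x‖ ≤ ‖x‖ :=
  norm_le_of_forall (norm_nonneg x) fun f hf => by
    rw [ev_trunc]; exact abs_ev_le_norm (hf.cut a b) x

/-- The vector `x` is supported in the interval `[a, b)`. -/
def VSupp (x : X) (a b : ℕ) : Prop := ∀ n, coord x n ≠ 0 → a ≤ n ∧ n < b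

theorem vsupp_trunc (a b : ℕ) (x : X) : VSupp (trunc a b x) a b := fun n hn => by
  rw [coord_trunc] at hn; by_contra h; rw [if_neg h] at hn; exact hn rfl

theorem VSupp.mono {x : X} {a b c d : ℕ} (h : VSupp x a b) (hca : c ≤ a) (hbd : b ≤ d) :
    VSupp x c d := fun n hn => ⟨hca.trans (h n hn).1, (h n hn).2.trans_le hbd⟩

theorem VSupp.coord_eq_zero {x : X} {a b n : ℕ} (h : VSupp x a b) (hn : n < a ∨ b ≤ n) :
    coord x n = 0 := by
  by_contra h0; have := h n h0; omega

theorem VSupp.smul {x : X} {a b : ℕ} (h : VSupp x a b) (c : ℝ) : VSupp (c • x) a b :=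
  fun n hn => h n fun h0 => hn (by rw [coord_smul, h0, mul_zero])

theorem VSupp.sum {ι : Type*} {s : Finset ι} {x : ι → X} {a b : ℕ}
    (h : ∀ i ∈ s, VSupp (x i) a b) : VSupp (∑ i ∈ s, x i) a b := fun n hn => by
  rw [coord_sum] at hn
  obtain ⟨i, hi, hne⟩ := exists_ne_zero_of_sum_ne_zero hn
  exact h i hi n hne

/-- Disjointly supported functionals and vectors annihilate each other. -/
theorem ev_eq_zero {f : Fn} {x : X} {a b c d : ℕ} (hf : SuppIn f a b) (hx : VSupp x c d)
    (h : b ≤ c ∨ d ≤ a) : ev f x = 0 := by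
  rw [← ev_zero f]
  refine ev_congr fun n hn => hx.coord_eq_zero ?_
  have := hf n hn
  omega

theorem ev_cut_of_vsupp {f : Fn} {x : X} {a b : ℕ} (hx : VSupp x a b) :
    ev (cut a b f) x = ev f x := by
  rw [← ev_trunc]
  refine ev_congr fun n _ => ?_
  rw [coord_trunc]
  split_ifs with h
  · rfl
  · exact (hx.coord_eq_zero (by omega)).symm

theorem norm_le_of_suppIn {x : X} {a b : ℕ} {C : ℝ} (hC : 0 ≤ C) (hx : VSupp x a b)
    (h : ∀ f, Norming none f → SuppIn f a b → |ev f x| ≤ C) : ‖x‖ ≤ C :=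
  norm_le_of_forall hC fun f hf => by
    rw [← ev_cut_of_vsupp hx]; exact h _ (hf.cut a b) (suppIn_cut a b f)

/-- Functionals of large weight are small on a given finitely supported vector. -/
theorem abs_ev_le_of_weight {k : ℕ} {g : Fn} (hg : Norming (some k) g) {x : X} {a b : ℕ}
    (hx : VSupp x a b) : |ev g x| ≤ b * ‖x‖ * (wt k : ℝ)⁻¹ := by
  rw [← ev_cut_of_vsupp hx, ev, pair_apply]
  have hsub : (cut a b g).support ⊆ range b := fun n hn =>
    mem_range.2 (suppIn_cut a b g n (Finsupp.mem_support_iff.1 hn)).2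
  calc _ ≤ ∑ n ∈ (cut a b g).support, |((cut a b g n : ℚ) : ℝ) * coord x n| :=
        abs_sum_le_sum_abs _ _
    _ ≤ ∑ n ∈ range b, |((cut a b g n : ℚ) : ℝ) * coord x n| :=
        sum_le_sum_of_subset_of_nonneg hsub fun _ _ _ => abs_nonneg _
    _ ≤ ∑ n ∈ range b, (wt k : ℝ)⁻¹ * ‖x‖ := sum_le_sum fun n _ => by
        rw [abs_mul]
        have := (hg.cut a b).abs_apply_le n
        simp only [Option.elim] at this
        exact mul_le_mul this (abs_coord_le x n) (abs_nonneg _) (by positivity)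
    _ = _ := by rw [sum_const, card_range, nsmul_eq_mul]; ring

/-- The unit vectors. -/
theorem exists_unit (n : ℕ) : ∃ x : X, ‖x‖ ≤ 1 ∧ ∀ m, coord x m = if m = n then 1 else 0 := by
  have hp : ∀ f, Norming none f → |pair (fun m => if m = n then 1 else 0) f| ≤ 1 := by
    intro f hf
    have : pair (fun m => if m = n then 1 else 0) f = f n := by
      rw [pair_apply]
      simp only [mul_ite, mul_one, mul_zero, sum_ite_eq', Finsupp.mem_support_iff]
      split_ifs with h
      · rfl
      · rw [not_not.1 h, Rat.cast_zero]
    rw [this]; exact hf.abs_apply_le n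
  obtain ⟨x, hx⟩ := exists_coord_eq hp
  refine ⟨x, norm_le_of_forall zero_le_one fun f hf => ?_, hx⟩
  have : coord x = fun m => if m = n then 1 else 0 := funext hx
  rw [ev, this]; exact hp f hf

theorem Norming.weight_zero (k : ℕ) : Norming (some k) 0 := by
  rcases Nat.even_or_odd k with hk | hk
  · exact .zero_of_even hk
  · simpa using Norming.odd k hk (fun _ => 0) (fun _ => 0) monotone_const
      (fun _ => suppIn_zero _ _) (fun _ => .zero_of_even (code_even _ _)) 0 0

/-! ### Norms over a single weight and the ℓ₂ rule. -/

/-- The supremum of a vector over the functionals of weight `k`. -/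
noncomputable def wnorm (k : ℕ) (x : X) : ℝ := ⨆ g : {g // Norming (some k) g}, |ev g x|

theorem bddAbove_weight (k : ℕ) (x : X) :
    BddAbove (Set.range fun g : {g // Norming (some k) g} => |ev g x|) :=
  ⟨‖x‖, by rintro _ ⟨g, rfl⟩; exact abs_ev_le_norm g.2.of_weight x⟩

theorem abs_ev_le_wnorm {k : ℕ} {g : Fn} (hg : Norming (some k) g) (x : X) :
    |ev g x| ≤ wnorm k x := le_ciSup (bddAbove_weight k x) ⟨g, hg⟩

theorem wnorm_nonneg (k : ℕ) (x : X) : 0 ≤ wnorm k x :=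
  (abs_nonneg _).trans (abs_ev_le_wnorm (.weight_zero k) x)

theorem exists_wnorm_lt (k : ℕ) (x : X) {η : ℝ} (hη : 0 < η) :
    ∃ g, Norming (some k) g ∧ wnorm k x - η < |ev g x| := by
  have : Nonempty {g // Norming (some k) g} := ⟨⟨0, .weight_zero k⟩⟩
  obtain ⟨g, hg⟩ := exists_lt_of_lt_ciSup (show wnorm k x - η < wnorm k x by linarith)
  exact ⟨g, g.2, hg⟩

/-- Rational vectors in the Euclidean ball determine the Euclidean norm. -/
theorem sum_sq_le_of_rat {s : Finset ℕ} {v : ℕ → ℝ} {M : ℝ} (hM : 0 ≤ M)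
    (h : ∀ c : ℕ → ℚ, ∑ k ∈ s, c k ^ 2 ≤ 1 → ∑ k ∈ s, (c k : ℝ) * v k ≤ M) :
    ∑ k ∈ s, v k ^ 2 ≤ M ^ 2 := by
  by_contra! hlt
  set S := ∑ k ∈ s, v k ^ 2 with hS
  have hSpos : 0 < S := (sq_nonneg M).trans_lt hlt
  have hr : 0 < √S := Real.sqrt_pos.2 hSpos
  have hrS : √S * √S = S := Real.mul_self_sqrt hSpos.le
  have hMr : M < √S := Real.lt_sqrt_of_sq_lt hlt
  -- The rational c k is chosen between l * v k and v k / √S: the upper multiple keeps c in the unit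
  -- ball, the lower one makes its value at v at least l * S > M.
  obtain ⟨l, hl1, hl2⟩ := exists_between (show M / S < 1 / √S by
    rw [div_lt_div_iff₀ hSpos hr]; nlinarith)
  have hl0 : 0 ≤ l := (div_nonneg hM hSpos.le).trans hl1.le
  have hc : ∀ k, ∃ c : ℚ, l * v k ^ 2 ≤ c * v k ∧ (c : ℝ) ^ 2 ≤ (1 / √S) ^ 2 * v k ^ 2 := by
    intro k
    rcases lt_trichotomy (v k) 0 with hv | hv | hv
    · obtain ⟨c, h1, h2⟩ := exists_rat_btwn (mul_lt_mul_of_neg_right hl2 hv)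
      have : l * v k ≤ 0 := mul_nonpos_of_nonneg_of_nonpos hl0 hv.le
      exact ⟨c, by nlinarith, by rw [← mul_pow]; nlinarith⟩
    · exact ⟨0, by simp [hv], by simp [hv]⟩
    · obtain ⟨c, h1, h2⟩ := exists_rat_btwn (mul_lt_mul_of_pos_right hl2 hv)
      have : 0 ≤ l * v k := mul_nonneg hl0 hv.le
      exact ⟨c, by nlinarith, by rw [← mul_pow]; nlinarith⟩
  choose c hc1 hc2 using hc
  have hsum : ∑ k ∈ s, (c k : ℝ) ^ 2 ≤ 1 := by
    calc _ ≤ ∑ k ∈ s, (1 / √S) ^ 2 * v k ^ 2 := sum_le_sum fun k _ => hc2 k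
      _ = 1 := by rw [← mul_sum, ← hS, div_pow, Real.sq_sqrt hSpos.le]; field_simp
  have := h c (by exact_mod_cast hsum)
  have h2 : l * S ≤ ∑ k ∈ s, (c k : ℝ) * v k := by
    rw [hS, mul_sum]; exact sum_le_sum fun k _ => hc1 k
  rw [div_lt_iff₀ hSpos] at hl1
  linarith

/-- Almost optimal functionals of distinct weights, with signs moved into the coefficients, may be
combined by any rational vector of the Euclidean ball. -/
theorem sum_wnorm_sq_le (s : Finset ℕ) (x : X) : ∑ k ∈ s, wnorm k x ^ 2 ≤ ‖x‖ ^ 2 := by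
  refine sum_sq_le_of_rat (norm_nonneg x) fun c hc => ?_
  refine le_of_forall_pos_le_add fun δ hδ => ?_
  choose g hg1 hg2 using fun k => exists_wnorm_lt k x (show 0 < δ / (#s + 1) by positivity)
  have hcomb := Norming.comb s (fun k => if 0 ≤ ev (g k) x then |c k| else -|c k|) g
    (by refine le_trans (le_of_eq (sum_congr rfl fun k _ => ?_)) hc
        split_ifs <;> simp) fun k _ => hg1 k
  have h1 := (le_abs_self _).trans (abs_ev_le_norm hcomb x)
  rw [sum_ev] at h1
  calc ∑ k ∈ s, (c k : ℝ) * wnorm k x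
      ≤ ∑ k ∈ s, (ev ((if 0 ≤ ev (g k) x then |c k| else -|c k|) • g k) x + δ / (#s + 1)) := by
        refine sum_le_sum fun k hk => ?_
        have hck : |(c k : ℝ)| ≤ 1 := by
          have : c k ^ 2 ≤ 1 := (single_le_sum (fun i _ => sq_nonneg (c i)) hk).trans hc
          rw [← sq_le_one_iff_abs_le_one]; exact_mod_cast this
        have e1 : ev ((if 0 ≤ ev (g k) x then |c k| else -|c k|) • g k) x
            = |(c k : ℝ)| * |ev (g k) x| := by
          rw [smul_ev]
          split_ifs with h
          · rw [abs_of_nonneg h]; push_cast; rfl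
          · rw [abs_of_neg (not_le.1 h)]; push_cast; ring
        rw [e1]
        have h3 := hg2 k
        have h4 := wnorm_nonneg k x
        have h5 : (0 : ℝ) < δ / (#s + 1) := by positivity
        have h6 := le_abs_self (c k : ℝ)
        have h7 := abs_nonneg (c k : ℝ)
        nlinarith
    _ ≤ ‖x‖ + δ := by
        rw [sum_add_distrib, sum_const, nsmul_eq_mul]
        have : (#s : ℝ) * (δ / (#s + 1)) ≤ δ := by
          rw [mul_div_assoc', div_le_iff₀ (by positivity)]; nlinarith
        linarith

theorem abs_sum_mul_ev_le {s : Finset ℕ} (c : ℕ → ℚ) {g : ℕ → Fn}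
    (hg : ∀ k ∈ s, Norming (some k) (g k)) (x : X) :
    |∑ k ∈ s, (c k : ℝ) * ev (g k) x| ≤ √(∑ k ∈ s, (c k : ℝ) ^ 2) * √(∑ k ∈ s, wnorm k x ^ 2) := by
  calc _ ≤ ∑ k ∈ s, |(c k : ℝ) * ev (g k) x| := abs_sum_le_sum_abs _ _
    _ ≤ ∑ k ∈ s, |(c k : ℝ)| * wnorm k x := sum_le_sum fun k hk => by
        rw [abs_mul]
        exact mul_le_mul_of_nonneg_left (abs_ev_le_wnorm (hg k hk) x) (abs_nonneg _)
    _ ≤ √(∑ k ∈ s, |(c k : ℝ)| ^ 2) * √(∑ k ∈ s, wnorm k x ^ 2) :=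
        Real.sum_mul_le_sqrt_mul_sqrt _ _ _
    _ = _ := by simp only [sq_abs]

theorem abs_sum_mul_ev_le_norm {s : Finset ℕ} (c : ℕ → ℚ) {g : ℕ → Fn}
    (hg : ∀ k ∈ s, Norming (some k) (g k)) (x : X) :
    |∑ k ∈ s, (c k : ℝ) * ev (g k) x| ≤ √(∑ k ∈ s, (c k : ℝ) ^ 2) * ‖x‖ :=
  (abs_sum_mul_ev_le c hg x).trans <| mul_le_mul_of_nonneg_left
    (Real.sqrt_le_iff.2 ⟨norm_nonneg x, sum_wnorm_sq_le s x⟩) (Real.sqrt_nonneg _)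

theorem abs_coef_le_one {s : Finset ℕ} {c : ℕ → ℚ} (hc : ∑ k ∈ s, c k ^ 2 ≤ 1) {k : ℕ}
    (hk : k ∈ s) : |(c k : ℝ)| ≤ 1 := by
  have : c k ^ 2 ≤ 1 := (single_le_sum (fun i _ => sq_nonneg (c i)) hk).trans hc
  rw [← sq_le_one_iff_abs_le_one]; exact_mod_cast this

/-- A combination of functionals of weights at least `K` is small at vectors that are small for each
of these weights. -/
theorem abs_sum_mul_ev_le_of_weight {s : Finset ℕ} {c : ℕ → ℚ} (hc : ∑ k ∈ s, c k ^ 2 ≤ 1)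
    {g : ℕ → Fn} {x : X} {K : ℕ} (hK : ∀ k ∈ s, K ≤ k) {D : ℝ} (hD : 0 ≤ D)
    (h : ∀ k ∈ s, |ev (g k) x| ≤ D * (wt k : ℝ)⁻¹) :
    |∑ k ∈ s, (c k : ℝ) * ev (g k) x| ≤ D * (2 / wt K) := by
  calc _ ≤ ∑ k ∈ s, |(c k : ℝ) * ev (g k) x| := abs_sum_le_sum_abs _ _
    _ ≤ ∑ k ∈ s, D * (wt k : ℝ)⁻¹ := sum_le_sum fun k hk => by
        rw [abs_mul]
        have h1 := abs_coef_le_one hc hk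
        have h2 := h k hk
        have h3 := abs_nonneg (ev (g k) x)
        nlinarith
    _ ≤ _ := by rw [← mul_sum]; exact mul_le_mul_of_nonneg_left (sum_inv_wt_le hK) hD

/-! ### The tree estimate and sums of blocks. -/

/-- Over the successive pieces of the functional the increments of φ telescope, so only the additive
error is multiplied by the length. -/
theorem weight_estimate {y : X} {φ : ℕ → ℕ} (hφ : Monotone φ) {κ E : ℝ} (hκ : 0 ≤ κ)
    (h : ∀ f a b, Norming none f → a ≤ b → SuppIn f a b → |ev f y| ≤ κ * ((φ b : ℝ) - φ a) + E)
    {k : ℕ} {g : Fn} (hg : Norming (some k) g) {a b : ℕ} (hab : a ≤ b) (hs : SuppIn g a b) :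
    |ev g y| ≤ (κ * ((φ b : ℝ) - φ a) + len k * E) * (wt k : ℝ)⁻¹ := by
  obtain ⟨f, r, hr, hrb, hfs, hf, rfl⟩ := hg.decomp hab hs
  have hw : (0 : ℝ) ≤ (wt k : ℝ)⁻¹ := by positivity
  rw [smul_ev, sum_ev, abs_mul]
  push_cast
  rw [abs_of_nonneg hw, mul_comm]
  refine mul_le_mul_of_nonneg_right ?_ hw
  calc _ ≤ ∑ t ∈ range (len k), |ev (f t) y| := abs_sum_le_sum_abs _ _
    _ ≤ ∑ t ∈ range (len k), (κ * ((φ (r (t + 1)) : ℝ) - φ (r t)) + E) :=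
        sum_le_sum fun t _ => h _ _ _ (hf t) (hr (Nat.le_succ t)) (hfs t)
    _ = κ * ((φ (r (len k)) : ℝ) - φ (r 0)) + len k * E := by
        rw [sum_add_distrib, ← mul_sum, sum_range_sub (fun t => (φ (r t) : ℝ)), sum_const,
          card_range, nsmul_eq_mul]
    _ ≤ _ := by
        have h1 : (φ (r (len k)) : ℝ) ≤ φ b := by exact_mod_cast hφ (hrb _).2
        have h2 : (φ a : ℝ) ≤ φ (r 0) := by exact_mod_cast hφ (hrb _).1
        have := mul_le_mul_of_nonneg_left (show (φ (r (len k)) : ℝ) - φ (r 0) ≤ φ b - φ a by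
          linarith) hκ
        linarith

/-- Estimates for combinations of large weights propagate to the whole norming set. -/
theorem tree_estimate {y : X} {φ : ℕ → ℕ} (hφ : Monotone φ) {K n : ℕ} (hn : ∀ k < K, len k ≤ n)
    {C ε B : ℝ} (hC : 0 ≤ C) (hε : 0 ≤ ε) (hunit : ∀ n, |coord y n| ≤ B)
    (base : ∀ f a b, Norming none f → a ≤ b → SuppIn f a b →
      |ev f y| ≤ C * ((φ b : ℝ) - φ a) + C)
    (tail : ∀ (s : Finset ℕ) (c : ℕ → ℚ) (g : ℕ → Fn) (a b : ℕ), ∑ k ∈ s, c k ^ 2 ≤ 1 →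
      (∀ k ∈ s, K ≤ k) → (∀ k ∈ s, Norming (some k) (g k)) → a ≤ b →
      (∀ k ∈ s, SuppIn (g k) a b) →
      |∑ k ∈ s, (c k : ℝ) * ev (g k) y| ≤ ε * ((φ b : ℝ) - φ a) + B) (d : ℕ) :
    ∀ f a b, Norming none f → a ≤ b → SuppIn f a b →
      |ev f y| ≤ (C / 2 ^ d + 2 * ε) * ((φ b : ℝ) - φ a) + (n + 2) ^ d * (2 * C + 2 * ε + B) := by
  have hB : 0 ≤ B := (abs_nonneg _).trans (hunit 0)
  have hsub : ∀ a b, a ≤ b → 0 ≤ (φ b : ℝ) - φ a := fun a b hab =>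
    sub_nonneg.2 (by exact_mod_cast hφ hab)
  induction d with
  | zero =>
    intro f a b hf hab hs
    have h1 := base f a b hf hab hs
    have h2 := hsub a b hab
    simp only [pow_zero, div_one, one_mul]
    nlinarith
  | succ d ih =>
    intro f a b hf hab hs
    set T := 2 * C + 2 * ε + B with hT
    set E := ((n : ℝ) + 2) ^ d * T with hE
    set κ := C / 2 ^ d + 2 * ε with hκ
    have hT0 : 0 ≤ T := by positivity
    have hκ0 : 0 ≤ κ := by positivity
    have hTE : T ≤ E := le_mul_of_one_le_left hT0 (one_le_pow₀ (by
      have := Nat.cast_nonneg (α := ℝ) n; linarith))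
    -- The limit 2ε is the fixed point of κ ↦ κ/2 + ε, the effect of one level.
    have hκ' : C / 2 ^ (d + 1) + 2 * ε = κ / 2 + ε := by rw [hκ, pow_succ]; field_simp; ring
    have hE' : ((n : ℝ) + 2) ^ (d + 1) * T = (n + 2) * E := by rw [hE, pow_succ]; ring
    have hD := hsub a b hab
    rw [hκ', hE']
    set D := (φ b : ℝ) - φ a with hDdef
    have hn0 : (0 : ℝ) ≤ n := Nat.cast_nonneg n
    have hBE : B ≤ E := le_trans (by rw [hT]; linarith) hTE
    cases hf with
    | unit m c hc =>
      rw [ev_single, abs_mul]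
      have h1 : |(c : ℝ)| ≤ 1 := by exact_mod_cast hc
      have h2 := hunit m
      have h3 := abs_nonneg (coord y m)
      nlinarith [mul_nonneg hn0 (hB.trans hBE), mul_nonneg hκ0 hD, mul_nonneg hε hD]
    | comb s c g hc hg =>
      have hcut : ev (∑ k ∈ s, c k • g k) y = ∑ k ∈ s, (c k : ℝ) * ev (cut a b (g k)) y := by
        rw [← hs.cut_eq, map_sum, sum_ev]
        exact sum_congr rfl fun k _ => by rw [map_smul, smul_ev]
      -- Weights below K have length at most n and go through the induction hypothesis, where the
      -- sum of the 1/m_k gives the factor 1/2; the others are left to `tail`.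
      rw [hcut, ← sum_filter_add_sum_filter_not s (fun k => k < K)]
      have htail := tail {k ∈ s | ¬k < K} c (fun k => cut a b (g k)) a b
        ((sum_le_sum_of_subset_of_nonneg (filter_subset _ _) fun _ _ _ => sq_nonneg _).trans hc)
        (fun k hk => not_lt.1 (mem_filter.1 hk).2)
        (fun k hk => (hg k (mem_filter.1 hk).1).cut a b) hab (fun k _ => suppIn_cut _ _ _)
      have hhead : |∑ k ∈ s with k < K, (c k : ℝ) * ev (cut a b (g k)) y|
          ≤ (κ * D + n * E) * (1 / 2) := by
        calc _ ≤ ∑ k ∈ s with k < K, |(c k : ℝ) * ev (cut a b (g k)) y| :=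
              abs_sum_le_sum_abs _ _
          _ ≤ ∑ k ∈ s with k < K, (κ * D + n * E) * (wt k : ℝ)⁻¹ := by
              refine sum_le_sum fun k hk => ?_
              obtain ⟨hks, hkK⟩ := mem_filter.1 hk
              have h1 := weight_estimate hφ hκ0 ih ((hg k hks).cut a b) hab (suppIn_cut _ _ _)
              have h2 : (len k : ℝ) ≤ n := by exact_mod_cast hn k hkK
              have h3 := abs_coef_le_one hc hks
              have h4 := abs_nonneg (ev (cut a b (g k)) y)
              rw [abs_mul]
              calc _ ≤ |ev (cut a b (g k)) y| := by nlinarith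
                _ ≤ _ := h1
                _ ≤ _ := by gcongr
          _ ≤ _ := by
              rw [← mul_sum]
              exact mul_le_mul_of_nonneg_left (sum_inv_wt_le_half _) (by
                have := hB.trans hBE; positivity)
      refine (abs_add_le _ _).trans ?_
      nlinarith [mul_nonneg hn0 (hB.trans hBE)]

section Blocks

variable {x : ℕ → X} {p : ℕ → ℕ}

/-- Number of the first `N` blocks that start before `b`. -/
def cnt (p : ℕ → ℕ) (N b : ℕ) : ℕ := #{i ∈ range N | p i < b}

theorem cnt_mono (p : ℕ → ℕ) (N : ℕ) : Monotone (cnt p N) := fun a b hab =>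
  card_le_card fun i hi => by
    simp only [mem_filter] at hi ⊢; exact ⟨hi.1, hi.2.trans_le hab⟩

theorem cnt_sub_le (p : ℕ → ℕ) (N a b : ℕ) : (cnt p N b : ℝ) - cnt p N a ≤ N := by
  have h : cnt p N b ≤ N := (card_filter_le _ _).trans_eq (card_range N)
  have h1 : (cnt p N b : ℝ) ≤ N := by exact_mod_cast h
  have h2 := Nat.cast_nonneg (α := ℝ) (cnt p N a)
  linarith

/-- The blocks among the first `N` that meet `[a, b)`. -/
def meets (p : ℕ → ℕ) (N a b : ℕ) : Finset ℕ := {i ∈ range N | p i < b ∧ a < p (i + 1)}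

/-- A block meeting the interval either starts inside it or straddles its left end; the latter
happens at most once. -/
theorem card_meets_le (hp : StrictMono p) (N : ℕ) {a b : ℕ} (hab : a ≤ b) :
    (#(meets p N a b) : ℝ) ≤ (cnt p N b : ℝ) - cnt p N a + 1 := by
  have hsub : meets p N a b ⊆ ({i ∈ range N | p i < b} \ {i ∈ range N | p i < a}) ∪
      {i ∈ range N | p i < a ∧ a < p (i + 1)} := fun i hi => by
    simp only [meets, mem_filter, mem_union, mem_sdiff] at hi ⊢; tauto
  have hone : #{i ∈ range N | p i < a ∧ a < p (i + 1)} ≤ 1 := by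
    refine card_le_one.2 fun i hi j hj => ?_
    simp only [mem_filter] at hi hj
    by_contra hne
    rcases lt_or_gt_of_ne hne with h | h
    · have := hp.monotone (show i + 1 ≤ j by omega); omega
    · have := hp.monotone (show j + 1 ≤ i by omega); omega
  have h1 := (card_le_card hsub).trans (card_union_le _ _)
  have hss : {i ∈ range N | p i < a} ⊆ {i ∈ range N | p i < b} := fun i hi => by
    simp only [mem_filter] at hi ⊢; exact ⟨hi.1, hi.2.trans_le hab⟩
  rw [card_sdiff_of_subset hss] at h1
  have h2 := cnt_mono p N hab
  have h3 : #(meets p N a b) + cnt p N a ≤ cnt p N b + 1 := by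
    unfold cnt at *; omega
  have : (#(meets p N a b) : ℝ) + cnt p N a ≤ cnt p N b + 1 := by exact_mod_cast h3
  linarith

theorem ev_sum_blocks (hx : ∀ i, VSupp (x i) (p i) (p (i + 1))) (N : ℕ)
    {f : Fn} {a b : ℕ} (hf : SuppIn f a b) :
    ev f (∑ i ∈ range N, x i) = ∑ i ∈ meets p N a b, ev f (x i) := by
  rw [ev_sum, meets]
  symm
  refine sum_subset (filter_subset _ _) fun i hi hn => ev_eq_zero hf (hx i) ?_
  simp only [mem_filter, not_and] at hn
  have := hn hi
  omega

theorem base_estimate (hp : StrictMono p) (hx : ∀ i, VSupp (x i) (p i) (p (i + 1))) {C : ℝ}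
    (hC : ∀ i, ‖x i‖ ≤ C) (N : ℕ) {f : Fn} {a b : ℕ} (h : Norming none f) (hab : a ≤ b)
    (hf : SuppIn f a b) :
    |ev f (∑ i ∈ range N, x i)| ≤ C * ((cnt p N b : ℝ) - cnt p N a) + C := by
  rw [ev_sum_blocks hx N hf]
  have hC0 : 0 ≤ C := (norm_nonneg _).trans (hC 0)
  calc _ ≤ ∑ i ∈ meets p N a b, |ev f (x i)| := abs_sum_le_sum_abs _ _
    _ ≤ ∑ i ∈ meets p N a b, C := sum_le_sum fun i _ => (abs_ev_le_norm h _).trans (hC i)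
    _ ≤ _ := by
      rw [sum_const, nsmul_eq_mul]
      have := card_meets_le hp N hab
      nlinarith

theorem abs_coord_sum_le (hp : StrictMono p) (hx : ∀ i, VSupp (x i) (p i) (p (i + 1))) {C : ℝ}
    (hC : ∀ i, ‖x i‖ ≤ C) (N n : ℕ) : |coord (∑ i ∈ range N, x i) n| ≤ C := by
  have hC0 : 0 ≤ C := (norm_nonneg _).trans (hC 0)
  rw [coord_sum]
  by_cases hex : ∃ i ∈ range N, coord (x i) n ≠ 0
  · obtain ⟨i, hi, hne⟩ := hex
    rw [sum_eq_single_of_mem i hi fun j _ hj => ?_]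
    · exact (abs_coord_le _ _).trans (hC i)
    · refine (hx j).coord_eq_zero ?_
      have h1 := hx i n hne
      rcases lt_or_gt_of_ne hj with h | h
      · have := hp.monotone (show j + 1 ≤ i by omega); omega
      · have := hp.monotone (show i + 1 ≤ j by omega); omega
  · push Not at hex
    rw [sum_eq_zero hex]; simpa using hC0

open Classical in
/-- If each block is small for all combinations of weights at least `K` outside an exceptional set,
and the exceptional sets are disjoint, then the sum is small for all combinations of weights
at least `K`. -/
theorem tail_estimate (hp : StrictMono p) (hx : ∀ i, VSupp (x i) (p i) (p (i + 1))) {C : ℝ}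
    (hC : ∀ i, ‖x i‖ ≤ C) (N : ℕ) {A : ℕ → Set ℕ} (hA : ∀ i j, i ≠ j → Disjoint (A i) (A j))
    {K : ℕ} {ε : ℝ} (hε : 0 ≤ ε)
    (hsmall : ∀ i, ∀ (s : Finset ℕ) (c : ℕ → ℚ) (g : ℕ → Fn), ∑ k ∈ s, c k ^ 2 ≤ 1 →
      (∀ k ∈ s, K ≤ k ∧ k ∉ A i) → (∀ k ∈ s, Norming (some k) (g k)) →
      |∑ k ∈ s, (c k : ℝ) * ev (g k) (x i)| ≤ ε)
    {s : Finset ℕ} {c : ℕ → ℚ} {g : ℕ → Fn} {a b : ℕ} (hc : ∑ k ∈ s, c k ^ 2 ≤ 1)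
    (hs : ∀ k ∈ s, K ≤ k) (hg : ∀ k ∈ s, Norming (some k) (g k)) (hab : a ≤ b)
    (hsupp : ∀ k ∈ s, SuppIn (g k) a b) :
    |∑ k ∈ s, (c k : ℝ) * ev (g k) (∑ i ∈ range N, x i)|
      ≤ ε * ((cnt p N b : ℝ) - cnt p N a) + (ε + C * √N) := by
  have hC0 : 0 ≤ C := (norm_nonneg _).trans (hC 0)
  set M := meets p N a b with hM
  have h1 : ∑ k ∈ s, (c k : ℝ) * ev (g k) (∑ i ∈ range N, x i)
      = ∑ i ∈ M, (∑ k ∈ s with k ∈ A i, (c k : ℝ) * ev (g k) (x i)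
        + ∑ k ∈ s with k ∉ A i, (c k : ℝ) * ev (g k) (x i)) := by
    simp only [sum_filter_add_sum_filter_not]
    rw [sum_comm]
    refine sum_congr rfl fun k hk => ?_
    rw [ev_sum_blocks hx N (hsupp k hk), mul_sum]
  have h2 : ∀ i ∈ M, |∑ k ∈ s with k ∉ A i, (c k : ℝ) * ev (g k) (x i)| ≤ ε := fun i _ =>
    hsmall i _ c g
      ((sum_le_sum_of_subset_of_nonneg (filter_subset _ _) fun _ _ _ => sq_nonneg _).trans hc)
      (fun k hk => ⟨hs k (mem_filter.1 hk).1, (mem_filter.1 hk).2⟩)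
      fun k hk => hg k (mem_filter.1 hk).1
  have h3 : ∀ i ∈ M, |∑ k ∈ s with k ∈ A i, (c k : ℝ) * ev (g k) (x i)|
      ≤ √(∑ k ∈ s with k ∈ A i, (c k : ℝ) ^ 2) * C := fun i _ =>
    (abs_sum_mul_ev_le_norm c (fun k hk => hg k (mem_filter.1 hk).1) (x i)).trans
      (mul_le_mul_of_nonneg_left (hC i) (Real.sqrt_nonneg _))
  -- Disjointness of the exceptional sets: the blocks share one coefficient vector of the ℓ₂ ball.
  -- Cauchy–Schwarz over the blocks then gives √N in place of N.
  have h4 : ∑ i ∈ M, ∑ k ∈ s with k ∈ A i, (c k : ℝ) ^ 2 ≤ 1 := by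
    rw [← sum_biUnion fun i _ j _ hij => ?_]
    · refine le_trans (sum_le_sum_of_subset_of_nonneg (t := s) ?_ fun _ _ _ => sq_nonneg _)
        (by exact_mod_cast hc)
      exact biUnion_subset.2 fun i _ => filter_subset _ _
    · refine Finset.disjoint_left.2 fun k hk hk' => ?_
      exact Set.disjoint_left.1 (hA i j hij) (mem_filter.1 hk).2 (mem_filter.1 hk').2
  have hMN : (#M : ℝ) ≤ N := by
    have : #M ≤ N := (card_filter_le _ _).trans_eq (card_range N)
    exact_mod_cast this
  have h5 : ∑ i ∈ M, √(∑ k ∈ s with k ∈ A i, (c k : ℝ) ^ 2) ≤ √N := by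
    have := Real.sum_mul_le_sqrt_mul_sqrt M (fun _ => 1)
      fun i => √(∑ k ∈ s with k ∈ A i, (c k : ℝ) ^ 2)
    simp only [one_mul, one_pow, sum_const, nsmul_eq_mul, mul_one] at this
    refine this.trans ?_
    rw [sum_congr rfl fun i _ => Real.sq_sqrt (sum_nonneg fun k _ => sq_nonneg _)]
    calc _ ≤ √N * 1 := mul_le_mul (Real.sqrt_le_sqrt hMN) (Real.sqrt_le_one.2 h4)
          (Real.sqrt_nonneg _) (Real.sqrt_nonneg _)
      _ = _ := mul_one _
  rw [h1]
  calc _ ≤ ∑ i ∈ M, (√(∑ k ∈ s with k ∈ A i, (c k : ℝ) ^ 2) * C + ε) :=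
        (abs_sum_le_sum_abs _ _).trans <| sum_le_sum fun i hi =>
          (abs_add_le _ _).trans (add_le_add (h3 i hi) (h2 i hi))
    _ = (∑ i ∈ M, √(∑ k ∈ s with k ∈ A i, (c k : ℝ) ^ 2)) * C + #M * ε := by
        rw [sum_add_distrib, sum_mul, sum_const, nsmul_eq_mul]
    _ ≤ _ := by
        have := card_meets_le hp N hab
        nlinarith [mul_le_mul_of_nonneg_right h5 hC0]

end Blocks

/-! ### Disjoint weights and small Schreier sums. -/

theorem exists_wt_large (D : ℝ) {ε : ℝ} (hε : 0 < ε) : ∃ J, ∀ K ≥ J, D * (2 / wt K) ≤ ε := by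
  obtain ⟨J, hJ⟩ := exists_nat_ge (|D| * 2 / ε)
  refine ⟨J, fun K hK => ?_⟩
  have h1 : (J : ℝ) ≤ wt K := by exact_mod_cast hK.trans (le_wt K)
  have hw : (0 : ℝ) < wt K := by exact_mod_cast wt_pos K
  have h2 := hJ.trans h1
  rw [div_le_iff₀ hε] at h2
  rw [mul_div_assoc', div_le_iff₀ hw]
  have := le_abs_self D
  linarith

/-- Recursive constructions use this form: `u t` is the state before step t, so the object chosen in
step t is read off from `u (t + 1)`. -/
theorem exists_seq_of_step {S : Type*} {R : S → S → Prop} (h : ∀ s, ∃ s', R s s') (s₀ : S) :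
    ∃ u : ℕ → S, u 0 = s₀ ∧ ∀ t, R (u t) (u (t + 1)) := by
  choose next hnext using h
  exact ⟨fun t => Nat.rec s₀ (fun _ s => next s) t, rfl, fun t => hnext _⟩

section Blocks

variable {x : ℕ → X} {p : ℕ → ℕ}

/-- The depth d stays free: a large d removes the ℓ₁ constant C, at the price of a factor (n + 2)^d
that multiplies only √N and constants. -/
theorem block_sum_estimate (hp : StrictMono p) (hx : ∀ i, VSupp (x i) (p i) (p (i + 1))) {C : ℝ}
    (hC : ∀ i, ‖x i‖ ≤ C) (N : ℕ) {A : ℕ → Set ℕ} (hA : ∀ i j, i ≠ j → Disjoint (A i) (A j))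
    {K n : ℕ} (hn : ∀ k < K, len k ≤ n) {ε : ℝ} (hε : 0 ≤ ε)
    (hsmall : ∀ i, ∀ (s : Finset ℕ) (c : ℕ → ℚ) (g : ℕ → Fn), ∑ k ∈ s, c k ^ 2 ≤ 1 →
      (∀ k ∈ s, K ≤ k ∧ k ∉ A i) → (∀ k ∈ s, Norming (some k) (g k)) →
      |∑ k ∈ s, (c k : ℝ) * ev (g k) (x i)| ≤ ε) (d : ℕ) {f : Fn} {a b : ℕ}
    (hf : Norming none f) (hab : a ≤ b) (hs : SuppIn f a b) :
    |ev f (∑ i ∈ range N, x i)| ≤ (C / 2 ^ d + 2 * ε) * ((cnt p N b : ℝ) - cnt p N a)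
      + (n + 2) ^ d * (3 * C + 3 * ε + C * √N) := by
  have hC0 : 0 ≤ C := (norm_nonneg _).trans (hC 0)
  have h0 : 0 ≤ C * √N := by positivity
  have := tree_estimate (cnt_mono p N) hn hC0 hε (B := ε + C * √N + C)
    (fun n => (abs_coord_sum_le hp hx hC N n).trans (by linarith))
    (fun f a b hf hab hs => base_estimate hp hx hC N hf hab hs)
    (fun s c g a b hc hK hg hab hs =>
      (tail_estimate hp hx hC N hA hε hsmall hc hK hg hab hs).trans (by linarith)) d f a b hf hab hs
  convert this using 3
  ring

theorem norm_block_sum_le (hp : StrictMono p) (hx : ∀ i, VSupp (x i) (p i) (p (i + 1))) {κ E : ℝ}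
    (hκ : 0 ≤ κ) (hE : 0 ≤ E) (N : ℕ)
    (h : ∀ f a b, Norming none f → a ≤ b → SuppIn f a b →
      |ev f (∑ i ∈ range N, x i)| ≤ κ * ((cnt p N b : ℝ) - cnt p N a) + E) :
    ‖∑ i ∈ range N, x i‖ ≤ κ * N + E := by
  have hs : VSupp (∑ i ∈ range N, x i) 0 (p N) := VSupp.sum fun i hi =>
    (hx i).mono (Nat.zero_le _) (hp.monotone (mem_range.1 hi))
  refine norm_le_of_suppIn (by positivity) hs fun f hf hfs => ?_
  refine (h f _ _ hf (Nat.zero_le _) hfs).trans ?_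
  have := mul_le_mul_of_nonneg_left (cnt_sub_le p N 0 (p N)) hκ
  linarith

/-- The lower estimate provided by the functionals of even weight. -/
theorem exists_lower_functional (hp : StrictMono p) (hx : ∀ i, VSupp (x i) (p i) (p (i + 1)))
    {k : ℕ} (hk : Even k) {N : ℕ} (hN : N ≤ len k) {f : ℕ → Fn} (hf : ∀ i, Norming none (f i))
    (hs : ∀ i, SuppIn (f i) (p i) (p (i + 1))) :
    Norming (some k) ((wt k : ℚ)⁻¹ • ∑ t ∈ range N, f t) ∧
      ev ((wt k : ℚ)⁻¹ • ∑ t ∈ range N, f t) (∑ i ∈ range N, x i)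
        = (wt k : ℝ)⁻¹ * ∑ i ∈ range N, ev (f i) (x i) := by
  refine ⟨.even_of_le hk hN hp.monotone (fun t _ => hs t) fun t _ => hf t, ?_⟩
  rw [smul_ev, sum_ev]
  push_cast
  congr 1
  refine sum_congr rfl fun t ht => ?_
  rw [ev_sum]
  refine sum_eq_single_of_mem t ht fun i _ hi => ev_eq_zero (hs t) (hx i) ?_
  rcases lt_or_gt_of_ne hi with h | h
  · exact .inr (hp.monotone h)
  · exact .inl (hp.monotone h)

/-- Norming functionals of the single blocks, cut to the blocks, form a functional of even weight
without any further restriction. -/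
theorem lower_estimate (hp : StrictMono p) (hx : ∀ i, VSupp (x i) (p i) (p (i + 1)))
    {k : ℕ} (hk : Even k) {N : ℕ} (hN : N ≤ len k) {c : ℝ} (hc : 0 ≤ c) (hxc : ∀ i, c < ‖x i‖) :
    N * c ≤ wt k * ‖∑ i ∈ range N, x i‖ := by
  choose f hf hfx using fun i => exists_lt_ev hc (hxc i)
  obtain ⟨h1, h2⟩ := exists_lower_functional hp hx hk hN
    (fun i => (hf i).cut (p i) (p (i + 1))) fun i => suppIn_cut _ _ _
  have h3 := (le_abs_self _).trans (abs_ev_le_norm h1.of_weight (∑ i ∈ range N, x i))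
  have hw : (0 : ℝ) < wt k := by exact_mod_cast wt_pos k
  rw [h2, inv_mul_le_iff₀ hw] at h3
  refine le_trans ?_ h3
  calc (N : ℝ) * c = ∑ i ∈ range N, c := by rw [sum_const, card_range, nsmul_eq_mul]
    _ ≤ _ := sum_le_sum fun i _ => by rw [ev_cut_of_vsupp (hx i)]; exact (hfx i).le

/-- A subsequence of a bounded block sequence is, up to small errors and finitely many weights,
supported on disjoint sets of weights. -/
theorem exists_disjoint_weights (hx : ∀ i, VSupp (x i) (p i) (p (i + 1))) {C : ℝ}
    (hC : ∀ i, ‖x i‖ ≤ C) {ε : ℝ} (hε : 0 < ε) :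
    ∃ K, ∀ n₀ : ℕ, ∃ (ψ : ℕ → ℕ) (A : ℕ → Set ℕ), StrictMono ψ ∧ n₀ ≤ ψ 0 ∧
      (∀ i j, i ≠ j → Disjoint (A i) (A j)) ∧
      ∀ i, ∀ (s : Finset ℕ) (c : ℕ → ℚ) (g : ℕ → Fn), ∑ k ∈ s, c k ^ 2 ≤ 1 →
        (∀ k ∈ s, K ≤ k ∧ k ∉ A i) → (∀ k ∈ s, Norming (some k) (g k)) →
        |∑ k ∈ s, (c k : ℝ) * ev (g k) (x (ψ i))| ≤ 2 * ε := by
  have hC0 : 0 ≤ C := (norm_nonneg _).trans (hC 0)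
  have hsum : ∀ i (s : Finset ℕ), ∑ k ∈ s, wnorm k (x i) ^ 2 ≤ C ^ 2 := fun i s =>
    (sum_wnorm_sq_le s (x i)).trans (pow_le_pow_left₀ (norm_nonneg _) (hC i) 2)
  have hmem : ∀ i, (fun k => wnorm k (x i) ^ 2) ∈
      Set.pi Set.univ fun _ : ℕ => Set.Icc (0 : ℝ) (C ^ 2) := fun i k _ =>
    ⟨sq_nonneg _, by simpa using hsum i {k}⟩
  -- By compactness the squared weight profiles converge weight by weight; the limit is summable,
  -- and K marks where its tail drops below ε².
  obtain ⟨α, -, θ, hθ, hlim⟩ := (isCompact_univ_pi fun _ => isCompact_Icc).tendsto_subseq hmem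
  rw [tendsto_pi_nhds] at hlim
  have hlimsum : ∀ s : Finset ℕ, Filter.Tendsto (fun i => ∑ k ∈ s, wnorm k (x (θ i)) ^ 2)
      Filter.atTop (nhds (∑ k ∈ s, α k)) := fun s => tendsto_finsetSum _ fun k _ => hlim k
  have hα0 : ∀ k, 0 ≤ α k := fun k => ge_of_tendsto' (hlim k) fun i => sq_nonneg _
  have hαs : Summable α := summable_of_sum_le hα0 fun s =>
    le_of_tendsto' (hlimsum s) fun i => hsum _ s
  obtain ⟨s₀, hs₀⟩ := summable_iff_vanishing_norm.1 hαs (ε ^ 2) (by positivity)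
  set K := s₀.sup id + 1 with hK
  have htail : ∀ L, ∑ k ∈ Ico K L, α k < ε ^ 2 := fun L => by
    refine (le_abs_self _).trans_lt (hs₀ _ (Finset.disjoint_left.2 fun k hk hk' => ?_))
    have : k ≤ s₀.sup id := le_sup (f := id) hk'
    have := (mem_Ico.1 hk).1
    omega
  -- K is fixed before n₀, so the number of blocks may be chosen from K and the start n₀ from that
  -- number.
  refine ⟨K, fun n₀ => ?_⟩
  -- The state is an index and a weight threshold. The next vector is small on weights from K to the
  -- old threshold by convergence, and on weights beyond the new one by its finite support; its
  -- exceptional set lies between the two.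
  obtain ⟨u, hu0, hu⟩ := exists_seq_of_step (S := ℕ × ℕ)
    (R := fun u v => u.1 < v.1 ∧ u.2 ≤ v.2 ∧ ∑ k ∈ Ico K u.2, wnorm k (x v.1) ^ 2 ≤ ε ^ 2 ∧
      p (v.1 + 1) * C * (2 / wt v.2) ≤ ε) (fun u => by
      obtain ⟨i, hi1, hi2⟩ := (((hlimsum (Ico K u.2)).eventually_lt_const (htail _)).and
        (hθ.tendsto_atTop.eventually_gt_atTop u.1)).exists
      obtain ⟨J, hJ⟩ := exists_wt_large (p (θ i + 1) * C) hε
      exact ⟨(θ i, max u.2 J), hi2, le_max_left _ _, hi1.le, hJ _ (le_max_right _ _)⟩) (n₀, K)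
  have hmono : Monotone fun t => (u t).2 := monotone_nat_of_le_succ fun t => (hu t).2.1
  refine ⟨fun t => (u (t + 1)).1, fun t => Set.Ico (u t).2 (u (t + 1)).2,
    strictMono_nat_of_lt_succ fun t => (hu (t + 1)).1, ?_, fun i j hij => ?_, ?_⟩
  · have := (hu 0).1; rw [hu0] at this; exact this.le
  · refine Set.disjoint_left.2 fun k hk hk' => ?_
    rcases lt_or_gt_of_ne hij with h | h
    · have := hmono (show i + 1 ≤ j from h)
      exact absurd (hk.2.trans_le (this.trans hk'.1)) (lt_irrefl _)
    · have := hmono (show j + 1 ≤ i from h)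
      exact absurd (hk'.2.trans_le (this.trans hk.1)) (lt_irrefl _)
  · intro t s c g hc hk hg
    obtain ⟨-, -, h3, h4⟩ := hu t
    rw [← sum_filter_add_sum_filter_not s (fun k => k < (u t).2)]
    have hle : ∀ q : ℕ → Prop, ∀ [DecidablePred q], ∑ k ∈ s with q k, c k ^ 2 ≤ 1 := fun q _ =>
      (sum_le_sum_of_subset_of_nonneg (filter_subset _ _) fun _ _ _ => sq_nonneg _).trans hc
    have e1 : |∑ k ∈ s with k < (u t).2, (c k : ℝ) * ev (g k) (x (u (t + 1)).1)| ≤ ε := by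
      refine (abs_sum_mul_ev_le c (fun k hk => hg k (mem_filter.1 hk).1) _).trans ?_
      have h5 : √(∑ k ∈ s with k < (u t).2, (c k : ℝ) ^ 2) ≤ 1 :=
        Real.sqrt_le_one.2 (by exact_mod_cast hle _)
      have h6 : √(∑ k ∈ s with k < (u t).2, wnorm k (x (u (t + 1)).1) ^ 2) ≤ ε := by
        refine Real.sqrt_le_iff.2 ⟨hε.le, le_trans ?_ h3⟩
        refine sum_le_sum_of_subset_of_nonneg (fun k hk' => ?_) fun _ _ _ => sq_nonneg _
        obtain ⟨h7, h8⟩ := mem_filter.1 hk'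
        exact mem_Ico.2 ⟨(hk k h7).1, h8⟩
      nlinarith [Real.sqrt_nonneg (∑ k ∈ s with k < (u t).2, (c k : ℝ) ^ 2),
        Real.sqrt_nonneg (∑ k ∈ s with k < (u t).2, wnorm k (x (u (t + 1)).1) ^ 2)]
    have e2 : |∑ k ∈ s with ¬k < (u t).2, (c k : ℝ) * ev (g k) (x (u (t + 1)).1)| ≤ ε := by
      refine le_trans (abs_sum_mul_ev_le_of_weight (K := (u (t + 1)).2) (hle _) (fun k hk' => ?_)
        (by positivity) fun k hk' => ?_) h4
      · obtain ⟨h7, h8⟩ := mem_filter.1 hk'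
        have := (hk k h7).2
        simp only [Set.mem_Ico, not_and, not_lt] at this h8
        exact this h8
      · refine (abs_ev_le_of_weight (hg k (mem_filter.1 hk').1) (hx _)).trans ?_
        gcongr
        exact hC _
    exact (abs_add_le _ _).trans (by linarith)

/-- No bounded block sequence has a lower `ℓ₁` estimate on the sums over Schreier sets. -/
theorem exists_small_schreier_sum (hp : StrictMono p) (hx : ∀ i, VSupp (x i) (p i) (p (i + 1)))
    {C : ℝ} (hC : ∀ i, ‖x i‖ ≤ C) {δ : ℝ} (hδ : 0 < δ) :
    ∃ F : Finset ℕ, (∀ i ∈ F, #F ≤ i) ∧ ‖∑ i ∈ F, x i‖ < δ * #F := by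
  have hC0 : 0 ≤ C := (norm_nonneg _).trans (hC 0)
  obtain ⟨K, hK⟩ := exists_disjoint_weights hx hC (show 0 < δ / 16 by positivity)
  obtain ⟨d, hd⟩ := pow_unbounded_of_one_lt (4 * C / δ) (one_lt_two (α := ℝ))
  have hd' : C / 2 ^ d ≤ δ / 4 := by
    rw [div_lt_iff₀ hδ] at hd
    rw [div_le_iff₀ (by positivity)]; linarith
  set n := prevLen K
  set D := ((n : ℝ) + 2) ^ d * (4 * C + 6 * (δ / 16)) with hD
  -- With M² blocks the √N error is a multiple of M, hence at most (δ/4) M². The terms C/2^d and 2ε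
  -- contribute δ/4 each, in total 3δ/4 < δ. Starting at index M² makes the index set Schreier.
  obtain ⟨M, hM⟩ := exists_nat_ge (max 1 (D * 4 / δ))
  have hM1 : (1 : ℝ) ≤ M := (le_max_left _ _).trans hM
  have hM2 : D * 4 ≤ M * δ := (div_le_iff₀ hδ).1 ((le_max_right _ _).trans hM)
  obtain ⟨ψ, A, hψ, hψ0, hA, hsmall⟩ := hK (M ^ 2)
  have hq : StrictMono (p ∘ ψ) := hp.comp hψ
  have hxq : ∀ i, VSupp (x (ψ i)) (p (ψ i)) (p (ψ (i + 1))) := fun i =>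
    (hx _).mono le_rfl (hp.monotone (hψ (Nat.lt_succ_self i)))
  have hmain := norm_block_sum_le (p := p ∘ ψ) hq hxq (by positivity) (by positivity) (M ^ 2)
    (fun f a b hf hab hs => block_sum_estimate (p := p ∘ ψ) (x := fun i => x (ψ i)) hq hxq
    (fun i => hC _) (M ^ 2) hA (fun k hk => len_le_prevLen hk) (by positivity) hsmall d hf hab hs)
  have hinj : Function.Injective ψ := hψ.injective
  refine ⟨(range (M ^ 2)).image ψ, fun i hi => ?_, ?_⟩
  · rw [card_image_of_injective _ hinj, card_range]
    obtain ⟨t, -, rfl⟩ := mem_image.1 hi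
    exact hψ0.trans (hψ.monotone (Nat.zero_le t))
  · rw [card_image_of_injective _ hinj, card_range, sum_image fun a _ b _ h => hinj h]
    refine hmain.trans_lt ?_
    have hs : √((M ^ 2 : ℕ) : ℝ) = M := by push_cast; exact Real.sqrt_sq (by linarith)
    rw [hs]
    push_cast
    have h1 : ((n : ℝ) + 2) ^ d * (3 * C + 3 * (2 * (δ / 16)) + C * M) ≤ D * M := by
      rw [hD, mul_assoc]
      refine mul_le_mul_of_nonneg_left ?_ (by positivity)
      nlinarith
    have h2 : D * M ≤ δ / 4 * M ^ 2 := by nlinarith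
    have h3 : C / 2 ^ d * (M : ℝ) ^ 2 ≤ δ / 4 * M ^ 2 := by gcongr
    nlinarith [mul_pos hδ (show (0 : ℝ) < M ^ 2 by positivity)]

end Blocks

/-! ### Density, the shrinking basis and reflexivity. -/

theorem ev_sub_trunc {f : Fn} {b : ℕ} (hf : SuppIn f 0 b) (n : ℕ) (x : X) :
    ev f (x - trunc 0 n x) = ev (cut n b f) x := by
  have : f = cut 0 n f + cut n b f := by
    ext m
    rw [Finsupp.add_apply, cut_apply, cut_apply]
    by_cases h0 : f m = 0
    · simp [h0]
    · have := hf m h0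
      split_ifs <;> first | omega | simp
  rw [ev_sub, ev_trunc]
  nth_rewrite 1 [this]
  rw [ev, ev, ev, map_add]; ring

theorem norm_sub_trunc_le (n : ℕ) (x : X) : ‖x - trunc 0 n x‖ ≤ ‖x‖ :=
  norm_le_of_forall (norm_nonneg x) fun f hf => by
    obtain ⟨b, hb⟩ := exists_suppIn f
    rw [ev_sub_trunc hb]; exact abs_ev_le_norm (hf.cut n b) x

/-- Finitely supported vectors are dense. -/
theorem exists_norm_sub_trunc_le (x : X) {δ : ℝ} (hδ : 0 < δ) (n₀ : ℕ) :
    ∃ n, n₀ < n ∧ ‖x - trunc 0 n x‖ ≤ δ := by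
  -- Otherwise there are successive functionals with values above δ at x. Sums of n_k of them,
  -- divided by m_k, are in the norming set for even k, and n_k/m_k ≥ m_k is unbounded.
  by_contra! hcon
  obtain ⟨u, -, hu⟩ := exists_seq_of_step (S := {n : ℕ // n₀ < n} × Fn)
    (R := fun u v => u.1.1 ≤ v.1.1 ∧ Norming none v.2 ∧ SuppIn v.2 u.1 v.1 ∧ δ < ev v.2 x)
    (fun u => by
      obtain ⟨f, hf, hfx⟩ := exists_lt_ev hδ.le (hcon u.1 u.1.2)
      obtain ⟨b, hb⟩ := exists_suppIn f
      have hb' : SuppIn f 0 (max b u.1) := hb.mono le_rfl (le_max_left _ _)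
      rw [ev_sub_trunc hb'] at hfx
      exact ⟨(⟨max b u.1, u.1.2.trans_le (le_max_right _ _)⟩, cut u.1 (max b u.1) f),
        le_max_right _ _, hf.cut _ _, suppIn_cut _ _ _, hfx⟩) (⟨n₀ + 1, by omega⟩, 0)
  have hmono : Monotone fun t => (u t).1.1 := monotone_nat_of_le_succ fun t => (hu t).1
  obtain ⟨J, hJ⟩ := exists_wt_large ‖x‖ hδ
  have hw : (0 : ℝ) < wt (2 * J) := by exact_mod_cast wt_pos _
  have hn := Norming.even_of_le (even_two_mul J) le_rfl hmono (fun t _ => (hu t).2.2.1)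
    fun t _ => (hu t).2.1
  have h1 := (le_abs_self _).trans (abs_ev_le_norm hn.of_weight x)
  rw [smul_ev, sum_ev] at h1
  push_cast at h1
  rw [inv_mul_le_iff₀ hw] at h1
  have h2 : len (2 * J) * δ ≤ ∑ t ∈ range (len (2 * J)), ev (u (t + 1)).2 x := by
    calc len (2 * J) * δ = ∑ t ∈ range (len (2 * J)), δ := by
          rw [sum_const, card_range, nsmul_eq_mul]
      _ ≤ _ := sum_le_sum fun t _ => (hu t).2.2.2.le
  have h3 : (wt (2 * J) : ℝ) ^ 2 ≤ len (2 * J) := by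
    have := Nat.pow_le_pow_left (wt_le_root (2 * J)) 2
    unfold len; exact_mod_cast this
  have h4 := hJ (2 * J) (by omega)
  rw [mul_div_assoc', div_le_iff₀ hw] at h4
  have h5 : (wt (2 * J) : ℝ) ^ 2 * δ ≤ wt (2 * J) * ‖x‖ :=
    (mul_le_mul_of_nonneg_right h3 hδ.le).trans (h2.trans h1)
  have h6 : (wt (2 * J) : ℝ) * δ ≤ ‖x‖ := by
    rw [sq, mul_assoc] at h5; exact le_of_mul_le_mul_left h5 hw
  nlinarith [mul_pos hδ hw]

/-- The unit vectors of the space. -/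
noncomputable def unitVec (n : ℕ) : X := (exists_unit n).choose

theorem norm_unitVec_le (n : ℕ) : ‖unitVec n‖ ≤ 1 := (exists_unit n).choose_spec.1

theorem coord_unitVec (n m : ℕ) : coord (unitVec n) m = if m = n then 1 else 0 :=
  (exists_unit n).choose_spec.2 m

theorem trunc_eq_sum (n : ℕ) (x : X) :
    trunc 0 n x = ∑ m ∈ range n, coord x m • unitVec m := by
  refine ext_coord fun k => ?_
  rw [coord_trunc, coord_sum]
  simp [coord_smul, coord_unitVec]

theorem not_finiteDimensional : ¬ FiniteDimensional ℝ X := by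
  intro h
  have hli : LinearIndependent ℝ unitVec := linearIndependent_iff'.2 fun s g hg i hi => by
    have := congrArg (fun z => coord z i) hg
    simpa [coord_sum, coord_smul, coord_unitVec, coord_zero, hi] using this
  exact absurd hli.finite (not_finite_iff_infinite.2 inferInstance)

/-- The unit vector basis is shrinking. -/
theorem exists_shrinking (φ : StrongDual ℝ X) {δ : ℝ} (hδ : 0 < δ) :
    ∃ n, ∀ x : X, (∀ m < n, coord x m = 0) → |φ x| ≤ δ * ‖x‖ := by
  by_contra! hcon
  -- One η serves twice: cutting to a finite block costs φ at most δ/2, and a Schreier sum of norm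
  -- below η times its length contradicts φ ≥ δ/2 on each block.
  set η := δ / (2 * (‖φ‖ + 1)) with hη
  have hφ : 0 ≤ ‖φ‖ := norm_nonneg φ
  have hη0 : 0 < η := by positivity
  have hηφ : (‖φ‖ + 1) * η = δ / 2 := by rw [hη]; field_simp
  obtain ⟨u, -, hu⟩ := exists_seq_of_step (S := ℕ × X)
    (R := fun u v => u.1 < v.1 ∧ VSupp v.2 u.1 v.1 ∧ ‖v.2‖ ≤ 1 ∧ δ / 2 ≤ φ v.2) (fun u => by
      obtain ⟨x, hx0, hx⟩ := hcon u.1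
      have hne : 0 < ‖x‖ := by
        rcases (norm_nonneg x).eq_or_lt with h | h
        · rw [norm_eq_zero.1 h.symm] at hx; simp at hx
        · exact h
      set c : ℝ := (if 0 ≤ φ x then 1 else -1) * ‖x‖⁻¹ with hc
      have hφx : δ ≤ φ (c • x) := by
        have : φ (c • x) = |φ x| * ‖x‖⁻¹ := by
          rw [map_smul, smul_eq_mul, hc]
          split_ifs with h
          · rw [abs_of_nonneg h]; ring
          · rw [abs_of_neg (not_le.1 h)]; ring
        rw [this, ← div_eq_mul_inv, le_div_iff₀ hne]; exact hx.le
      have hnorm : ‖c • x‖ = 1 := by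
        rw [norm_smul, hc, norm_mul, norm_inv, norm_norm, mul_assoc, inv_mul_cancel₀ hne.ne']
        split_ifs <;> simp
      obtain ⟨b, hb, hbx⟩ := exists_norm_sub_trunc_le (c • x) hη0 u.1
      refine ⟨(b, trunc 0 b (c • x)), hb, fun n hn => ?_, (norm_trunc_le _ _ _).trans hnorm.le, ?_⟩
      · have h1 := (vsupp_trunc 0 b _ n hn).2
        refine ⟨?_, h1⟩
        by_contra hlt
        rw [coord_trunc, if_pos ⟨Nat.zero_le _, h1⟩, coord_smul, hx0 n (not_le.1 hlt)] at hn
        simp at hn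
      · have h1 := φ.le_opNorm (c • x - trunc 0 b (c • x))
        rw [map_sub, Real.norm_eq_abs] at h1
        have h2 := (le_abs_self _).trans h1
        nlinarith) (0, 0)
  have hp : StrictMono fun t => (u t).1 := strictMono_nat_of_lt_succ fun t => (hu t).1
  obtain ⟨F, -, hF⟩ := exists_small_schreier_sum (x := fun t => (u (t + 1)).2) hp
    (fun t => (hu t).2.1) (fun t => (hu t).2.2.1) hη0
  have h1 := (le_abs_self _).trans (φ.le_opNorm (∑ i ∈ F, (u (i + 1)).2))
  rw [map_sum] at h1
  have h2 : #F * (δ / 2) ≤ ∑ i ∈ F, φ (u (i + 1)).2 := by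
    rw [← nsmul_eq_mul]; exact card_nsmul_le_sum _ _ _ fun i _ => (hu i).2.2.2
  have h3 := norm_nonneg (∑ i ∈ F, (u (i + 1)).2)
  rw [← hηφ] at h2
  nlinarith

/-- The values of Φ at the coordinate functionals are bounded on the norming set, so they are the
coordinates of a vector. Since the basis is shrinking, coordinate functionals span a dense subspace
of the dual, and agreement there suffices. -/
theorem isReflexiveSpace : SpreadingModels.IsReflexiveSpace X := by
  intro Φ
  have hev : ∀ f : Fn, ∀ z : X, (∑ n ∈ f.support, (f n : ℝ) • coordL n) z = ev f z := by
    intro f z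
    rw [ev, pair_apply, _root_.sum_apply]
    exact sum_congr rfl fun n _ => by
      rw [_root_.smul_apply, coordL_apply, smul_eq_mul]
  obtain ⟨x, hx⟩ := exists_coord_eq (v := fun n => Φ (coordL n)) (C := ‖Φ‖) fun f hf => by
    have h1 : pair (fun n => Φ (coordL n)) f = Φ (∑ n ∈ f.support, (f n : ℝ) • coordL n) := by
      rw [pair_apply, map_sum]; simp
    have h2 : ‖∑ n ∈ f.support, (f n : ℝ) • coordL n‖ ≤ 1 :=
      ContinuousLinearMap.opNorm_le_bound _ zero_le_one fun z => by
        rw [hev, one_mul]; exact abs_ev_le_norm hf z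
    rw [h1]
    exact (Φ.le_opNorm _).trans (mul_le_of_le_one_right (norm_nonneg _) h2)
  refine ⟨x, ContinuousLinearMap.ext fun φ => ?_⟩
  rw [NormedSpace.dual_def]
  refine eq_of_forall_dist_le fun ε hε => ?_
  obtain ⟨n, hn⟩ := exists_shrinking φ (show 0 < ε / (‖Φ‖ + ‖x‖ + 1) by positivity)
  set δ := ε / (‖Φ‖ + ‖x‖ + 1) with hδ
  -- This is φ composed with the projection onto the first n coordinates.
  set ψ : StrongDual ℝ X := ∑ m ∈ range n, φ (unitVec m) • coordL m with hψ
  have hδ0 : 0 < δ := by positivity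
  have htail : ∀ z, |φ (z - trunc 0 n z)| ≤ δ * ‖z‖ := fun z => by
    refine (hn _ fun m hm => ?_).trans
      (mul_le_mul_of_nonneg_left (norm_sub_trunc_le n z) hδ0.le)
    rw [coord_sub, coord_trunc, if_pos ⟨Nat.zero_le _, hm⟩, sub_self]
  have hψz : ∀ z, ψ z = φ (trunc 0 n z) := fun z => by
    rw [trunc_eq_sum, map_sum, hψ, _root_.sum_apply]
    exact sum_congr rfl fun m _ => by
      rw [_root_.smul_apply, map_smul, coordL_apply, smul_eq_mul, smul_eq_mul,
        mul_comm]
  have hnorm : ‖φ - ψ‖ ≤ δ := ContinuousLinearMap.opNorm_le_bound _ hδ0.le fun z => by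
    rw [_root_.sub_apply, hψz, ← map_sub]; exact htail z
  have hΦψ : Φ ψ = φ (trunc 0 n x) := by
    rw [trunc_eq_sum, hψ, map_sum, map_sum]
    exact sum_congr rfl fun m _ => by
      rw [map_smul, map_smul, hx, smul_eq_mul, smul_eq_mul, mul_comm]
  have h1 : |Φ (φ - ψ)| ≤ ‖Φ‖ * δ :=
    (Φ.le_opNorm _).trans (mul_le_mul_of_nonneg_left hnorm (norm_nonneg _))
  have h2 := htail x
  rw [Real.dist_eq]
  have h3 : φ x - Φ φ = φ (x - trunc 0 n x) - Φ (φ - ψ) := by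
    rw [map_sub, map_sub, hΦψ]; ring
  have h4 : (‖Φ‖ + ‖x‖ + 1) * δ = ε := by rw [hδ]; field_simp
  rw [h3]
  refine (abs_sub _ _).trans ?_
  nlinarith

/-! ### No `ℓ_p` or `c₀` spreading model. -/

/-- The gliding hump: a coordinatewise null sequence has a subsequence close to a block sequence. -/
theorem exists_close_blocks {y : ℕ → X}
    (hy : ∀ n, Filter.Tendsto (fun i => coord (y i) n) Filter.atTop (nhds 0)) {η : ℝ} (hη : 0 < η) :
    ∃ (ψ : ℕ → ℕ) (b : ℕ → X) (p : ℕ → ℕ), StrictMono ψ ∧ StrictMono p ∧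
      (∀ t, VSupp (b t) (p t) (p (t + 1))) ∧ ∀ t, ‖y (ψ t) - b t‖ ≤ η * (1 / 2) ^ t := by
  obtain ⟨u, -, hu⟩ := exists_seq_of_step (S := ℕ × ℕ × X)
    (R := fun u v => u.1 < v.1 ∧ u.2.1 < v.2.1 ∧ VSupp v.2.2 u.2.1 v.2.1 ∧
      ‖y v.1 - v.2.2‖ ≤ η * (1 / 2) ^ u.1) (fun u => by
      have hδ : 0 < η * (1 / 2) ^ u.1 / 2 := by positivity
      have hlim : Filter.Tendsto (fun i => ∑ m ∈ range u.2.1, |coord (y i) m|) Filter.atTop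
          (nhds 0) := by
        simpa using tendsto_finsetSum (range u.2.1) fun m _ => (hy m).abs
      obtain ⟨i, hi1, hi2⟩ := ((hlim.eventually_lt_const hδ).and
        (Filter.eventually_gt_atTop u.1)).exists
      obtain ⟨q, hq, hqy⟩ := exists_norm_sub_trunc_le (y i) hδ u.2.1
      refine ⟨(i, q, trunc u.2.1 q (y i)), hi2, hq, vsupp_trunc _ _ _, ?_⟩
      have h1 : ‖trunc 0 u.2.1 (y i)‖ ≤ ∑ m ∈ range u.2.1, |coord (y i) m| := by
        rw [trunc_eq_sum]
        refine (norm_sum_le _ _).trans (sum_le_sum fun m _ => ?_)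
        rw [norm_smul, Real.norm_eq_abs]
        exact mul_le_of_le_one_right (abs_nonneg _) (norm_unitVec_le m)
      have h2 : y i - trunc u.2.1 q (y i) = (y i - trunc 0 q (y i)) + trunc 0 u.2.1 (y i) := by
        refine ext_coord fun n => ?_
        simp only [coord_sub, coord_add, coord_trunc]
        split_ifs <;> first | omega | ring
      dsimp only
      rw [h2]
      refine (norm_add_le _ _).trans ?_
      linarith) (0, 0, 0)
  have hmono : StrictMono fun t => (u t).1 := strictMono_nat_of_lt_succ fun t => (hu t).1
  refine ⟨fun t => (u (t + 1)).1, fun t => (u (t + 1)).2.2, fun t => (u t).2.1,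
    strictMono_nat_of_lt_succ fun t => (hu (t + 1)).1,
    strictMono_nat_of_lt_succ fun t => (hu t).2.1, fun t => (hu t).2.2.1, fun t => ?_⟩
  refine (hu t).2.2.2.trans (mul_le_mul_of_nonneg_left ?_ hη.le)
  exact pow_le_pow_of_le_one (by norm_num) (by norm_num) hmono.le_apply

/-- Differences along a subsequence of a bounded sequence are close to a block sequence. -/
theorem exists_blocks_of_bounded {x : ℕ → X} (hx : ∀ n, ‖x n‖ ≤ 1) {η : ℝ} (hη : 0 < η) :
    ∃ (σ τ : ℕ → ℕ) (b : ℕ → X) (p : ℕ → ℕ), StrictMono p ∧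
      (∀ t, VSupp (b t) (p t) (p (t + 1))) ∧ (∀ t, 2 * t + 2 ≤ σ t ∧ σ t < τ t) ∧
      (∀ s t, s < t → τ s < σ t) ∧
      ∀ t, ‖x (σ t) - x (τ t) - b t‖ ≤ η * (1 / 2) ^ t := by
  have hmem : ∀ i, coord (x i) ∈ Set.pi Set.univ fun _ : ℕ => Set.Icc (-1 : ℝ) 1 := fun i n _ =>
    abs_le.1 ((abs_coord_le _ n).trans (hx i))
  obtain ⟨z, -, θ, hθ, hlim⟩ := (isCompact_univ_pi fun _ => isCompact_Icc).tendsto_subseq hmem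
  rw [tendsto_pi_nhds] at hlim
  -- Differences of terms of a coordinatewise convergent subsequence are coordinatewise null. The
  -- offset 2i + 2 pushes indices far enough for the doubled Schreier sets used later.
  have h1 : Filter.Tendsto (fun i : ℕ => 2 * i + 2) Filter.atTop Filter.atTop :=
    (show StrictMono fun i : ℕ => 2 * i + 2 from fun i j h => by dsimp only; omega).tendsto_atTop
  have h2 : Filter.Tendsto (fun i : ℕ => 2 * i + 3) Filter.atTop Filter.atTop :=
    (show StrictMono fun i : ℕ => 2 * i + 3 from fun i j h => by dsimp only; omega).tendsto_atTop
  obtain ⟨ψ, b, p, hψ, hp, hb, hyb⟩ := exists_close_blocks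
    (y := fun i => x (θ (2 * i + 2)) - x (θ (2 * i + 3))) (fun n => by
      simpa [coord_sub] using ((hlim n).comp h1).sub ((hlim n).comp h2)) hη
  refine ⟨fun t => θ (2 * ψ t + 2), fun t => θ (2 * ψ t + 3), b, p, hp, hb, fun t => ?_,
    fun s t hst => hθ (by have := hψ hst; omega), hyb⟩
  have h3 : t ≤ ψ t := hψ.le_apply
  have h4 : 2 * ψ t + 2 ≤ θ (2 * ψ t + 2) := hθ.le_apply
  exact ⟨by dsimp only; omega, hθ (by omega)⟩

/-- Sums of the blocks from `exists_blocks_of_bounded` over Schreier sets are close to signed sums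
over Schreier sets of the original sequence. -/
theorem exists_signed_sum {x : ℕ → X} {η : ℝ} (hη : 0 < η) {σ τ : ℕ → ℕ} {b : ℕ → X}
    (hσ : ∀ t, 2 * t + 2 ≤ σ t ∧ σ t < τ t) (hτ : ∀ s t, s < t → τ s < σ t)
    (hb : ∀ t, ‖x (σ t) - x (τ t) - b t‖ ≤ η * (1 / 2) ^ t) {F : Finset ℕ}
    (hF : ∀ t ∈ F, #F ≤ t + 1) :
    ∃ (G : Finset ℕ) (a : ℕ → ℝ), SpreadingModels.IsSchreier G ∧ #G = 2 * #F ∧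
      (∀ i, |a i| = 1) ∧ ‖∑ i ∈ G, a i • x i - ∑ t ∈ F, b t‖ ≤ 2 * η := by
  have hσi : Set.InjOn σ F := fun s _ t _ h => by
    rcases lt_trichotomy s t with h1 | h1 | h1
    · have := hτ s t h1; have := (hσ s).2; omega
    · exact h1
    · have := hτ t s h1; have := (hσ t).2; omega
  have hτi : Set.InjOn τ F := fun s _ t _ h => by
    rcases lt_trichotomy s t with h1 | h1 | h1
    · have := hτ s t h1; have := (hσ t).2; omega
    · exact h1
    · have := hτ t s h1; have := (hσ s).2; omega
  have hne : ∀ s t, σ s ≠ τ t := fun s t h => by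
    rcases lt_trichotomy s t with h1 | h1 | h1
    · have := hτ s t h1; have := (hσ s).2; have := (hσ t).2; omega
    · subst h1; have := (hσ s).2; omega
    · have := hτ t s h1; omega
  have hdisj : Disjoint (F.image σ) (F.image τ) := Finset.disjoint_left.2 fun i hi hi' => by
    obtain ⟨s, -, rfl⟩ := mem_image.1 hi
    obtain ⟨t, -, h⟩ := mem_image.1 hi'
    exact hne s t h.symm
  have hcard : #(F.image σ ∪ F.image τ) = 2 * #F := by
    rw [card_union_of_disjoint hdisj, card_image_of_injOn hσi, card_image_of_injOn hτi]; ring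
  refine ⟨F.image σ ∪ F.image τ, fun i => if i ∈ F.image σ then 1 else -1, fun i hi => ?_, hcard,
    fun i => by dsimp only; split_ifs <;> simp, ?_⟩
  -- The indices are at least 2t + 2, and 2 #F ≤ 2t + 2.
  · rw [hcard]
    rcases mem_union.1 hi with hi | hi <;> obtain ⟨t, ht, rfl⟩ := mem_image.1 hi
    · have := hF t ht; have := hσ t; omega
    · have := hF t ht; have := hσ t; omega
  · have h1 : ∑ i ∈ F.image σ ∪ F.image τ, (if i ∈ F.image σ then (1 : ℝ) else -1) • x i
        = ∑ t ∈ F, (x (σ t) - x (τ t)) := by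
      rw [sum_union hdisj, sum_image hσi, sum_image hτi, ← sum_add_distrib]
      refine sum_congr rfl fun t ht => ?_
      rw [if_pos (mem_image_of_mem σ ht), if_neg (Finset.disjoint_right.1 hdisj
        (mem_image_of_mem τ ht)), one_smul, neg_one_smul, sub_eq_add_neg]
    rw [h1, ← sum_sub_distrib]
    calc _ ≤ ∑ t ∈ F, η * (1 / 2) ^ t := (norm_sum_le _ _).trans (sum_le_sum fun t _ => hb t)
      _ = η * ∑ t ∈ F, (1 / 2) ^ t := (mul_sum _ _ _).symm
      _ ≤ η * 2 := by
        refine mul_le_mul_of_nonneg_left ?_ hη.le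
        have := summable_geometric_two.sum_le_tsum F fun _ _ => by positivity
        rwa [tsum_geometric_two] at this
      _ = 2 * η := mul_comm _ _

/-- No bounded sequence has a lower `ℓ₁` estimate on Schreier sets. -/
theorem no_lower_ell_one {x : ℕ → X} (hx : ∀ n, ‖x n‖ ≤ 1) {c : ℝ} (hc : 0 < c)
    (h : ∀ G, SpreadingModels.IsSchreier G → ∀ a : ℕ → ℝ, (∀ i, |a i| = 1) →
      c * #G ≤ ‖∑ i ∈ G, a i • x i‖) : False := by
  -- The signed sum has 2 #F terms, so its norm is at least 2c #F, but it is within 2η = c of a sum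
  -- of norm below c #F.
  have hη : 0 < c / 2 := by positivity
  obtain ⟨σ, τ, b, p, hp, hb, hσ, hτ, hclose⟩ := exists_blocks_of_bounded hx hη
  have hbn : ∀ t, ‖b t‖ ≤ 2 + c / 2 := fun t => by
    have h1 : ‖b t‖ ≤ ‖x (σ t) - x (τ t)‖ + ‖x (σ t) - x (τ t) - b t‖ := by
      simpa using norm_sub_le (x (σ t) - x (τ t)) (x (σ t) - x (τ t) - b t)
    have h2 := norm_sub_le (x (σ t)) (x (τ t))
    have h3 := hx (σ t)
    have h4 := hx (τ t)
    have h5 : c / 2 * (1 / 2) ^ t ≤ c / 2 :=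
      mul_le_of_le_one_right hη.le (pow_le_one₀ (by norm_num) (by norm_num))
    have h6 := hclose t
    linarith
  obtain ⟨F, hF, hlt⟩ := exists_small_schreier_sum hp hb hbn hc
  obtain ⟨G, a, hG, hcard, ha, hdist⟩ := exists_signed_sum hη hσ hτ hclose
    (F := F) fun t ht => (hF t ht).trans (Nat.le_succ t)
  have h1 := h G hG a ha
  rw [hcard] at h1
  push_cast at h1
  have h2 := norm_sub_norm_le (∑ i ∈ G, a i • x i) (∑ t ∈ F, b t)
  have h3 := norm_nonneg (∑ t ∈ F, b t)
  have h4 : (1 : ℝ) ≤ #F := by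
    have : 0 < #F := by
      rcases Nat.eq_zero_or_pos #F with h0 | h0
      · rw [h0] at hlt; simp only [Nat.cast_zero, mul_zero] at hlt; linarith
      · exact h0
    exact_mod_cast this
  nlinarith

/-- No bounded sequence that is separated on Schreier sets has an upper estimate better than
`ℓ₁` on Schreier sets. -/
theorem no_upper_power {x : ℕ → X} (hx : ∀ n, ‖x n‖ ≤ 1) {c C θ : ℝ} (hc : 0 < c) (hC : 0 ≤ C)
    (hθ0 : 0 ≤ θ) (hθ : θ < 1)
    (hlow : ∀ G, G.Nonempty → SpreadingModels.IsSchreier G → ∀ a : ℕ → ℝ, (∀ i, |a i| = 1) →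
      c ≤ ‖∑ i ∈ G, a i • x i‖)
    (hup : ∀ G, G.Nonempty → SpreadingModels.IsSchreier G → ∀ a : ℕ → ℝ, (∀ i, |a i| = 1) →
      ‖∑ i ∈ G, a i • x i‖ ≤ C * (#G : ℝ) ^ θ) : False := by
  have hη : 0 < c / 8 := by positivity
  obtain ⟨σ, τ, b, p, hp, hb, hσ, hτ, hclose⟩ := exists_blocks_of_bounded hx hη
  have hbn : ∀ t, c / 2 < ‖b t‖ := fun t => by
    obtain ⟨G, a, hG, hcard, ha, hdist⟩ := exists_signed_sum hη hσ hτ hclose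
      (F := {t}) (by simp)
    have h1 := hlow G (card_pos.1 (by rw [hcard]; simp)) hG a ha
    have h2 := norm_sub_norm_le (∑ i ∈ G, a i • x i) (∑ t ∈ {t}, b t)
    rw [sum_singleton] at h2 hdist
    linarith
  set D := 4 * (C + c) / c with hD
  have key : ∀ j : ℕ, (len (2 * j) : ℝ) ^ (1 - θ) ≤ wt (2 * j) * D := by
    intro j
    set N := len (2 * j) with hN
    have hN0 : 0 < N := len_pos _
    have hN1 : (1 : ℝ) ≤ N := by exact_mod_cast hN0
    -- Shifting by N turns N consecutive blocks into a Schreier set.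
    have hq : StrictMono fun t => p (N + t) := fun s t h => hp (by omega)
    have h1 := lower_estimate (x := fun t => b (N + t)) hq (fun t => hb (N + t)) (even_two_mul j)
      le_rfl (by positivity) fun t => hbn (N + t)
    have hinj : Function.Injective fun t => N + t := add_right_injective N
    have hFcard : #((range N).image fun t => N + t) = N := by
      rw [card_image_of_injective _ hinj, card_range]
    obtain ⟨G, a, hG, hcard, ha, hdist⟩ := exists_signed_sum hη hσ hτ hclose
      (F := (range N).image fun t => N + t) (fun t ht => by
        rw [hFcard]; obtain ⟨s, -, rfl⟩ := mem_image.1 ht; omega)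
    rw [hFcard] at hcard
    rw [sum_image fun s _ t _ h => hinj h] at hdist
    have h2 := hup G (card_pos.1 (by omega)) hG a ha
    have h3 := norm_sub_norm_le (∑ t ∈ range N, b (N + t)) (∑ i ∈ G, a i • x i)
    rw [norm_sub_rev] at h3
    have hpow1 : (1 : ℝ) ≤ (N : ℝ) ^ θ := Real.one_le_rpow hN1 hθ0
    have h4 : ((#G : ℕ) : ℝ) ^ θ ≤ 2 * (N : ℝ) ^ θ := by
      rw [hcard, Nat.cast_mul, Real.mul_rpow (by norm_num) (by positivity)]
      refine mul_le_mul_of_nonneg_right ?_ (by positivity)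
      calc ((2 : ℕ) : ℝ) ^ θ ≤ ((2 : ℕ) : ℝ) ^ (1 : ℝ) :=
            Real.rpow_le_rpow_of_exponent_le (by norm_num) hθ.le
        _ = 2 := by simp
    have hw : (0 : ℝ) < wt (2 * j) := by exact_mod_cast wt_pos _
    have h5 : ‖∑ t ∈ range N, b (N + t)‖ ≤ 2 * (C + c) * (N : ℝ) ^ θ := by
      have : C * ((#G : ℕ) : ℝ) ^ θ ≤ C * (2 * (N : ℝ) ^ θ) := mul_le_mul_of_nonneg_left h4 hC
      nlinarith
    have h6 : (N : ℝ) ^ (1 - θ) * (N : ℝ) ^ θ = N := by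
      rw [← Real.rpow_add (by linarith), sub_add_cancel, Real.rpow_one]
    have h7 : (N : ℝ) * (c / 2) ≤ wt (2 * j) * (2 * (C + c) * (N : ℝ) ^ θ) :=
      h1.trans (mul_le_mul_of_nonneg_left h5 hw.le)
    nth_rewrite 1 [← h6] at h7
    have h8 : (N : ℝ) ^ (1 - θ) * (c / 2) ≤ wt (2 * j) * (2 * (C + c)) := by
      refine le_of_mul_le_mul_right (a := (N : ℝ) ^ θ) ?_ (by linarith)
      linarith
    rw [hD, mul_div_assoc', le_div_iff₀ hc]
    linarith
  -- As n_{2j} ≥ m_{2j}^j and j(1 - θ) ≥ 2, `key` yields m_{2j}² ≤ m_{2j} D, while m_{2j} ≥ j > D.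
  obtain ⟨j, hj⟩ := exists_nat_ge (max (D + 1) (2 / (1 - θ)))
  have hj1 : D + 1 ≤ j := (le_max_left _ _).trans hj
  have hj2 : 2 ≤ (j : ℝ) * (1 - θ) :=
    (div_le_iff₀ (by linarith)).1 ((le_max_right _ _).trans hj)
  have hw16 : (16 : ℝ) ≤ wt (2 * j) := by exact_mod_cast sixteen_le_wt _
  have hlen : (wt (2 * j) : ℝ) ^ j ≤ len (2 * j) := by
    have : wt (2 * j) ^ j ≤ len (2 * j) :=
      (Nat.pow_le_pow_right (wt_pos _) (by omega)).trans
        ((wt_pow_le_root _).trans (root_le_len _))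
    exact_mod_cast this
  have h1 : (wt (2 * j) : ℝ) ^ 2 ≤ wt (2 * j) * D := by
    calc (wt (2 * j) : ℝ) ^ 2 = (wt (2 * j) : ℝ) ^ (2 : ℝ) := by norm_cast
      _ ≤ (wt (2 * j) : ℝ) ^ ((j : ℝ) * (1 - θ)) :=
          Real.rpow_le_rpow_of_exponent_le (by linarith) hj2
      _ = ((wt (2 * j) : ℝ) ^ j) ^ (1 - θ) := by
          rw [Real.rpow_mul (by linarith), Real.rpow_natCast]
      _ ≤ (len (2 * j) : ℝ) ^ (1 - θ) :=
          Real.rpow_le_rpow (by positivity) hlen (by linarith)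
      _ ≤ _ := key j
  have h2 : (wt (2 * j) : ℝ) ≤ D := by
    rw [sq] at h1; exact le_of_mul_le_mul_left h1 (by linarith)
  have h3 : (j : ℝ) ≤ wt (2 * j) := by
    exact_mod_cast (show j ≤ 2 * j by omega).trans (le_wt _)
  linarith

theorem lpNormOn_of_abs_one {p : ℝ} {G : Finset ℕ} {a : ℕ → ℝ} (ha : ∀ i, |a i| = 1) :
    SpreadingModels.lpNormOn p G a = (#G : ℝ) ^ (1 / p) := by
  simp [SpreadingModels.lpNormOn, ha]

theorem c0NormOn_of_abs_one {G : Finset ℕ} (hG : G.Nonempty) {a : ℕ → ℝ} (ha : ∀ i, |a i| = 1) :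
    SpreadingModels.c0NormOn G a = 1 := by
  obtain ⟨i, hi⟩ := hG
  refine le_antisymm ((pi_norm_le_iff_of_nonneg zero_le_one).2 fun j => ?_) ?_
  · rw [Real.norm_eq_abs, ha]
  · have := norm_le_pi_norm (fun i : G => a i) ⟨i, hi⟩
    rwa [Real.norm_eq_abs, ha] at this

/-- Coefficients ±1 suffice: they have norm (#G)^(1/p), which for p = 1 is a forbidden lower
estimate and for p > 1 a forbidden upper one. -/
theorem not_admitsLp {p : ℝ} (hp : 1 ≤ p) : ¬ SpreadingModels.AdmitsLpSpreadingModel X p := by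
  rintro ⟨x, hx, -, C, hC, h⟩
  have hC0 : 0 < C := zero_lt_one.trans_le hC
  rcases hp.eq_or_lt with rfl | hp
  · refine no_lower_ell_one (fun n => (hx n).le) (inv_pos.2 hC0) fun G hG a ha => ?_
    have := (h G hG a).1
    rwa [lpNormOn_of_abs_one ha, div_one, Real.rpow_one] at this
  · refine no_upper_power (θ := 1 / p) (fun n => (hx n).le) (inv_pos.2 hC0) hC0.le
      (by positivity) ((div_lt_one (by linarith)).2 hp) (fun G hne hG a ha => ?_)
      fun G hne hG a ha => ?_
    · have := (h G hG a).1
      rw [lpNormOn_of_abs_one ha] at this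
      refine le_trans (le_mul_of_one_le_right (inv_pos.2 hC0).le ?_) this
      exact Real.one_le_rpow (by exact_mod_cast hne.card_pos) (by positivity)
    · have := (h G hG a).2
      rwa [lpNormOn_of_abs_one ha] at this

theorem not_admitsC0 : ¬ SpreadingModels.AdmitsC0SpreadingModel X := by
  rintro ⟨x, hx, -, C, hC, h⟩
  have hC0 : 0 < C := zero_lt_one.trans_le hC
  refine no_upper_power (θ := 0) (fun n => (hx n).le) (inv_pos.2 hC0) hC0.le
    le_rfl zero_lt_one (fun G hne hG a ha => ?_) fun G hne hG a ha => ?_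
  · have := (h G hG a).1
    rwa [c0NormOn_of_abs_one hne ha, mul_one] at this
  · have := (h G hG a).2
    rwa [c0NormOn_of_abs_one hne ha, ← Real.rpow_zero (#G : ℝ)] at this

/-! ### Averages, rapidly increasing sequences and exact pairs. -/

theorem sum_range_mul_eq {M : Type*} [AddCommMonoid M] (f : ℕ → M) (a b : ℕ) :
    ∑ i ∈ range (a * b), f i = ∑ l ∈ range a, ∑ i ∈ range b, f (l * b + i) := by
  induction a with
  | zero => simp
  | succ a ih => rw [Nat.succ_mul, sum_range_add, ih, sum_range_succ]

/-- A subspace containing finitely supported vectors arbitrarily far out. -/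
def Available (V : Submodule ℝ X) : Prop :=
  ∀ n, ∃ u ∈ V, ∃ b, n < b ∧ ‖u‖ = 1 ∧ VSupp u n b

theorem Available.exists_blocks {V : Submodule ℝ X} (hV : Available V) (n : ℕ) :
    ∃ (u : ℕ → X) (p : ℕ → ℕ), p 0 = n ∧ StrictMono p ∧
      ∀ i, u i ∈ V ∧ ‖u i‖ = 1 ∧ VSupp (u i) (p i) (p (i + 1)) := by
  obtain ⟨s, hs0, hs⟩ := exists_seq_of_step (S := ℕ × X)
    (R := fun s t => s.1 < t.1 ∧ t.2 ∈ V ∧ ‖t.2‖ = 1 ∧ VSupp t.2 s.1 t.1) (fun s => by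
      obtain ⟨u, hu, b, hb, hn, hsupp⟩ := hV s.1
      exact ⟨(b, u), hb, hu, hn, hsupp⟩) (n, 0)
  exact ⟨fun t => (s (t + 1)).2, fun t => (s t).1, congrArg Prod.fst hs0,
    strictMono_nat_of_lt_succ fun t => (hs t).1, fun i => (hs i).2⟩

theorem prevLen_mono : Monotone prevLen := monotone_nat_of_le_succ fun k => by
  cases k with
  | zero => exact Nat.zero_le _
  | succ k => exact len_le_succ k

/-- Long sums that are not much smaller than in `ℓ₁` exist in every available subspace. -/
theorem Available.exists_large_sum {V : Submodule ℝ X} (hV : Available V) (j n₀ : ℕ) :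
    ∃ (z : ℕ → X) (q : ℕ → ℕ), StrictMono q ∧ n₀ ≤ q 0 ∧
      (∀ i, z i ∈ V ∧ ‖z i‖ ≤ 1 ∧ VSupp (z i) (q i) (q (i + 1))) ∧
      ((prevLen j + 2 : ℕ) : ℝ) / 2 < ‖∑ i ∈ range (prevLen j + 2), z i‖ := by
  by_contra! hcon
  set n := prevLen j + 2 with hn
  have hn0 : 0 < n := by omega
  have hnR : (0 : ℝ) < n := by exact_mod_cast hn0
  obtain ⟨u, p, hp0, hp, hu⟩ := hV.exists_blocks n₀
  -- If every sum of n vectors of the unit ball lost a factor 2, grouping n^s blocks in s levels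
  -- would lose 2^s.
  have key : ∀ s i₀, ‖∑ i ∈ range (n ^ s), u (i₀ + i)‖ ≤ ((n : ℝ) / 2) ^ s := by
    intro s
    induction s with
    | zero => intro i₀; simpa using (hu i₀).2.1.le
    | succ s ih =>
      intro i₀
      have hpow : 0 < n ^ s := pow_pos hn0 s
      have hc : (0 : ℝ) < ((n : ℝ) / 2) ^ s := by positivity
      have h1 := hcon (fun l => (((n : ℝ) / 2) ^ s)⁻¹ • ∑ i ∈ range (n ^ s), u (i₀ + l * n ^ s + i))
        (fun l => p (i₀ + l * n ^ s))
        (fun a b hab => hp (by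
          have := (Nat.mul_lt_mul_right hpow).2 hab; omega))
        (by rw [← hp0]; exact hp.monotone (Nat.zero_le _))
        (fun l => ⟨V.smul_mem _ (V.sum_mem fun i _ => (hu _).1), ?_, VSupp.smul (VSupp.sum
          fun i hi => (hu _).2.2.mono (hp.monotone (by omega)) (hp.monotone ?_)) _⟩)
      · rw [← smul_sum, norm_smul, norm_inv, Real.norm_of_nonneg hc.le,
          inv_mul_le_iff₀ hc] at h1
        rw [pow_succ, mul_comm (n ^ s), sum_range_mul_eq, pow_succ]
        simpa only [add_assoc] using h1
      · rw [norm_smul, norm_inv, Real.norm_of_nonneg hc.le, inv_mul_le_iff₀ hc, mul_one]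
        exact ih _
      · have := mem_range.1 hi
        rw [Nat.succ_mul]; omega
  -- Then 2^s = 4 m_{2j}, so the loss contradicts the lower bound n^s / (2 m_{2j}) from weight 2j.
  set s := 2 ^ (2 * j + 2) + 2 with hs
  have hlen : n ^ s ≤ len (2 * j) := by
    refine le_trans ?_ (root_le_len _)
    rw [root_eq]
    refine le_trans ?_ (Nat.le_mul_of_pos_left _ (pow_pos (wt_pos _) _))
    have h1 : n ≤ prevLen (2 * j) + 2 := by
      have := prevLen_mono (show j ≤ 2 * j by omega); omega
    refine (Nat.pow_le_pow_left h1 _).trans (Nat.pow_le_pow_right (by omega) ?_)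
    have h2 : 2 ^ (2 * j + 4) = 2 ^ (2 * j + 2) * 4 := by rw [pow_add _ (2 * j) 4, pow_add]; ring
    have h3 : 0 < 2 ^ (2 * j + 2) := by positivity
    omega
  have h1 := lower_estimate hp (fun i => (hu i).2.2) (even_two_mul j) hlen (c := 1 / 2)
    (by norm_num) fun i => by rw [(hu i).2.1]; norm_num
  have h2 := key s 0
  simp only [zero_add] at h2
  have hw : (0 : ℝ) < wt (2 * j) := by exact_mod_cast wt_pos _
  have h3 : ((n ^ s : ℕ) : ℝ) * (1 / 2) ≤ wt (2 * j) * ((n : ℝ) / 2) ^ s :=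
    h1.trans (mul_le_mul_of_nonneg_left h2 hw.le)
  have h4 : (2 : ℝ) ^ s = wt (2 * j) * 4 := by
    rw [hs, pow_add]; unfold wt; push_cast; norm_num
  have h5 : (0 : ℝ) < (n : ℝ) ^ s := by positivity
  have h6 : (wt (2 * j) : ℝ) * ((n : ℝ) ^ s / (wt (2 * j) * 4)) = (n : ℝ) ^ s / 4 := by field_simp
  rw [div_pow, h4, h6, Nat.cast_pow] at h3
  linarith

/-- Every available subspace contains averages that are small for all functionals of weight
less than `j`. -/
theorem Available.exists_average {V : Submodule ℝ X} (hV : Available V) (j n₀ : ℕ) :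
    ∃ x ∈ V, ∃ b f, n₀ < b ∧ VSupp x n₀ b ∧ Norming none f ∧ SuppIn f n₀ b ∧ ev f x = 1 ∧
      ‖x‖ ≤ 2 ∧ ∀ k < j, ∀ g, Norming (some k) g → |ev g x| ≤ 4 * (wt k : ℝ)⁻¹ := by
  obtain ⟨z, q, hq, hq0, hz, hlarge⟩ := hV.exists_large_sum j n₀
  set n := prevLen j + 2 with hn
  have hnR : (0 : ℝ) < n := by have : 0 < n := by omega
                               exact_mod_cast this
  obtain ⟨f, hf, hfy⟩ := exists_lt_ev (by positivity) hlarge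
  set y := ∑ i ∈ range n, z i with hy
  have hsupp : VSupp y n₀ (q n) := VSupp.sum fun i hi =>
    (hz i).2.2.mono (hq0.trans (hq.monotone (Nat.zero_le i))) (hq.monotone (mem_range.1 hi))
  have hpos : 0 < ev f y := lt_trans (by positivity) hfy
  have hscale : ∀ a M : ℝ, |a| ≤ M → |(ev f y)⁻¹ * a| ≤ 2 / n * M := fun a M ha => by
    rw [abs_mul, abs_of_pos (inv_pos.2 hpos)]
    refine mul_le_mul ?_ ha (abs_nonneg a) (by positivity)
    rw [← inv_div]
    exact inv_anti₀ (by positivity) hfy.le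
  have hynorm : ‖y‖ ≤ n := by
    refine (norm_sum_le_of_le _ fun i _ => (hz i).2.1).trans ?_
    simp
  refine ⟨(ev f y)⁻¹ • y, V.smul_mem _ (V.sum_mem fun i _ => (hz i).1), q n, cut n₀ (q n) f,
    hq0.trans_lt (hq (by omega)), hsupp.smul _, hf.cut _ _, suppIn_cut _ _ _, ?_, ?_, ?_⟩
  · rw [ev_smul, ev_cut_of_vsupp hsupp, inv_mul_cancel₀ hpos.ne']
  · have := hscale ‖y‖ n (by rwa [abs_of_nonneg (norm_nonneg y)])
    rw [abs_of_nonneg (by positivity)] at this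
    rw [norm_smul, norm_inv, Real.norm_of_nonneg hpos.le]
    refine this.trans (le_of_eq ?_)
    field_simp
  -- Both the number of vectors and the length n_k are at most n, so |g(y)| ≤ 2n/m_k; normalization
  -- costs at most 2/n.
  · intro k hk g hg
    have h1 := weight_estimate (cnt_mono q n) zero_le_one (fun f a b hf hab hs =>
      base_estimate hq (fun i => (hz i).2.2) (fun i => (hz i).2.1) n hf hab hs)
      (hg.cut 0 (q n)) (Nat.zero_le _) (suppIn_cut _ _ _)
    rw [ev_cut_of_vsupp (hsupp.mono (Nat.zero_le _) le_rfl)] at h1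
    have h2 : (len k : ℝ) ≤ n := by
      have := len_le_prevLen hk
      exact_mod_cast (show len k ≤ n by omega)
    have h3 := cnt_sub_le q n 0 (q n)
    have hw : (0 : ℝ) ≤ (wt k : ℝ)⁻¹ := by positivity
    rw [ev_smul]
    refine (hscale _ _ h1).trans ?_
    calc _ ≤ 2 / n * ((2 * n) * (wt k : ℝ)⁻¹) := by
          refine mul_le_mul_of_nonneg_left (mul_le_mul_of_nonneg_right ?_ hw) (by positivity)
          linarith
      _ = _ := by field_simp; norm_num

/-- A pair consisting of a vector and a functional of weight `j` norming it, such that the vector is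
small for all functionals of other weights. -/
structure IsExactPair (j : ℕ) (x : X) (f : Fn) (a b : ℕ) : Prop where
  vsupp : VSupp x a b
  suppIn : SuppIn f a b
  norming : Norming (some j) f
  ev_eq : ev f x = 1
  norm_le : ‖x‖ ≤ 23
  small_lt : ∀ k < j, ∀ g, Norming (some k) g → |ev g x| ≤ 23 * (wt k : ℝ)⁻¹
  -- Stated for combinations, since the bound for a single weight above j does not decay with the
  -- weight and could not be summed.
  small_gt : ∀ (s : Finset ℕ) (c : ℕ → ℚ) (g : ℕ → Fn), ∑ k ∈ s, c k ^ 2 ≤ 1 →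
    (∀ k ∈ s, j < k) → (∀ k ∈ s, Norming (some k) (g k)) →
    |∑ k ∈ s, (c k : ℝ) * ev (g k) x| ≤ 23 * (wt j : ℝ)⁻¹

/-- Every available subspace contains rapidly increasing sequences. -/
theorem Available.exists_ris {V : Submodule ℝ X} (hV : Available V) (j n₀ : ℕ) :
    ∃ (x : ℕ → X) (f : ℕ → Fn) (p : ℕ → ℕ) (A : ℕ → Set ℕ), p 0 = n₀ ∧ StrictMono p ∧
      (∀ i, x i ∈ V ∧ VSupp (x i) (p i) (p (i + 1)) ∧ ‖x i‖ ≤ 2 ∧ Norming none (f i) ∧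
        SuppIn (f i) (p i) (p (i + 1)) ∧ ev (f i) (x i) = 1) ∧
      (∀ i i', i ≠ i' → Disjoint (A i) (A i')) ∧
      ∀ K ≤ j + 1, ∀ i, ∀ (s : Finset ℕ) (c : ℕ → ℚ) (g : ℕ → Fn), ∑ k ∈ s, c k ^ 2 ≤ 1 →
        (∀ k ∈ s, K ≤ k ∧ k ∉ A i) → (∀ k ∈ s, Norming (some k) (g k)) →
        |∑ k ∈ s, (c k : ℝ) * ev (g k) (x i)| ≤ 9 * (wt K : ℝ)⁻¹ := by
  have hwj : (0 : ℝ) < (wt (j + 1) : ℝ)⁻¹ := inv_pos.2 (by exact_mod_cast wt_pos _)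
  obtain ⟨u, hu0, hu⟩ := exists_seq_of_step (S := (ℕ × ℕ) × X × Fn)
    (R := fun u v => u.1.1 < v.1.1 ∧ u.1.2 ≤ v.1.2 ∧
      (v.2.1 ∈ V ∧ VSupp v.2.1 u.1.1 v.1.1 ∧ ‖v.2.1‖ ≤ 2 ∧ Norming none v.2.2 ∧
        SuppIn v.2.2 u.1.1 v.1.1 ∧ ev v.2.2 v.2.1 = 1) ∧
      (∀ k < u.1.2, ∀ g, Norming (some k) g → |ev g v.2.1| ≤ 4 * (wt k : ℝ)⁻¹) ∧
      v.1.1 * 2 * (2 / wt v.1.2) ≤ (wt (j + 1) : ℝ)⁻¹) (fun u => by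
      obtain ⟨x, hxV, b, f, hb, hx, hf, hfs, hfx, hnx, hsm⟩ := hV.exists_average u.1.2 u.1.1
      obtain ⟨J, hJ⟩ := exists_wt_large (b * 2) hwj
      exact ⟨((b, max u.1.2 J), x, f), hb, le_max_left _ _, ⟨hxV, hx, hnx, hf, hfs, hfx⟩, hsm,
        hJ _ (le_max_right _ _)⟩) ((n₀, j + 1), 0, 0)
  have hmono : Monotone fun t => (u t).1.2 := monotone_nat_of_le_succ fun t => (hu t).2.1
  refine ⟨fun t => (u (t + 1)).2.1, fun t => (u (t + 1)).2.2, fun t => (u t).1.1,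
    fun t => Set.Ico (u t).1.2 (u (t + 1)).1.2, congrArg (fun s => s.1.1) hu0,
    strictMono_nat_of_lt_succ fun t => (hu t).1, fun t => (hu t).2.2.1, fun i j hij => ?_, ?_⟩
  · refine Set.disjoint_left.2 fun k hk hk' => ?_
    rcases lt_or_gt_of_ne hij with h | h
    · have := hmono (show i + 1 ≤ j from h)
      exact absurd (hk.2.trans_le (this.trans hk'.1)) (lt_irrefl _)
    · have := hmono (show j + 1 ≤ i from h)
      exact absurd (hk'.2.trans_le (this.trans hk.1)) (lt_irrefl _)
  · intro K hK t s c g hc hk hg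
    obtain ⟨-, -, ⟨-, hx, hnx, -⟩, h3, h4⟩ := hu t
    have hle : ∀ q : ℕ → Prop, ∀ [DecidablePred q], ∑ k ∈ s with q k, c k ^ 2 ≤ 1 := fun q _ =>
      (sum_le_sum_of_subset_of_nonneg (filter_subset _ _) fun _ _ _ => sq_nonneg _).trans hc
    -- Below the old threshold the averages are small, which costs 4 · 2/m_K; beyond the new one
    -- finite support costs at most 1/m_{j+1} ≤ 1/m_K. Together this is 9/m_K.
    rw [← sum_filter_add_sum_filter_not s (fun k => k < (u t).1.2)]
    have e1 : |∑ k ∈ s with k < (u t).1.2, (c k : ℝ) * ev (g k) (u (t + 1)).2.1|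
        ≤ 4 * (2 / wt K) := by
      refine abs_sum_mul_ev_le_of_weight (hle _) (fun k hk' => ?_) (by norm_num) fun k hk' => ?_
      · exact (hk k (mem_filter.1 hk').1).1
      · exact h3 k (mem_filter.1 hk').2 _ (hg k (mem_filter.1 hk').1)
    have e2 : |∑ k ∈ s with ¬k < (u t).1.2, (c k : ℝ) * ev (g k) (u (t + 1)).2.1|
        ≤ (wt (j + 1) : ℝ)⁻¹ := by
      refine le_trans (abs_sum_mul_ev_le_of_weight (K := (u (t + 1)).1.2) (hle _)
        (fun k hk' => ?_) (by positivity) fun k hk' => ?_) h4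
      · obtain ⟨h7, h8⟩ := mem_filter.1 hk'
        have := (hk k h7).2
        simp only [Set.mem_Ico, not_and, not_lt] at this h8
        exact this h8
      · refine (abs_ev_le_of_weight (hg k (mem_filter.1 hk').1) hx).trans ?_
        gcongr
    have h5 : (wt (j + 1) : ℝ)⁻¹ ≤ (wt K : ℝ)⁻¹ := inv_anti₀ (by exact_mod_cast wt_pos K)
      (by exact_mod_cast wt_strictMono.monotone hK)
    refine (abs_add_le _ _).trans ?_
    rw [div_eq_mul_inv] at e1
    linarith

theorem wt_eq_two_pow (k : ℕ) : (2 : ℝ) ^ 2 ^ (k + 2) = wt k := by unfold wt; push_cast; rfl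

/-- The errors in the tree estimates are dominated by the lengths. -/
theorem root_slack (k : ℕ) {d : ℕ} (hd : d ≤ 2 ^ (k + 4)) :
    (wt k : ℝ) ^ 4 * ((prevLen k : ℝ) + 2) ^ d ≤ root k := by
  have h : wt k ^ 4 * (prevLen k + 2) ^ d ≤ root k :=
    (Nat.mul_le_mul_left _ (Nat.pow_le_pow_right (by omega) hd)).trans (wt_mul_le_root k)
  exact_mod_cast h

/-- Exact pairs of even weight exist in every available subspace. -/
theorem Available.exists_exactPair {V : Submodule ℝ X} (hV : Available V) {j : ℕ} (hj : Even j)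
    (n₀ : ℕ) : ∃ x ∈ V, ∃ f b, n₀ < b ∧ IsExactPair j x f n₀ b := by
  obtain ⟨x, f, p, A, hp0, hp, hx, hA, hsmall⟩ := hV.exists_ris j n₀
  set N := len j with hN
  set R := (root j : ℝ) with hR
  set w := (wt j : ℝ) with hw
  set n := prevLen j with hn
  -- At this depth 2^d = m_j.
  set d := 2 ^ (j + 2) with hd
  have hw16 : (16 : ℝ) ≤ w := by rw [hw]; exact_mod_cast sixteen_le_wt j
  have hNR : (N : ℝ) = R ^ 2 := by rw [hN, hR]; unfold len; push_cast; rfl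
  have hR0 : (0 : ℝ) < R := by rw [hR]; exact_mod_cast root_pos j
  have hN0 : (0 : ℝ) < N := by rw [hNR]; positivity
  have hsqrt : √(N : ℝ) = R := by rw [hNR]; exact Real.sqrt_sq hR0.le
  have h2d : (2 : ℝ) ^ d = w := wt_eq_two_pow j
  have hxv := fun i => (hx i).2.1
  have hxn := fun i => (hx i).2.2.1
  set y := ∑ i ∈ range N, x i with hy
  set E : ℝ := ((n : ℝ) + 2) ^ d * (10 * R) with hE
  have hn2 : (1 : ℝ) ≤ (n : ℝ) + 2 := by
    have := Nat.cast_nonneg (α := ℝ) n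
    linarith
  have hw4 : w ^ 4 ≤ R := by
    have := root_slack j (d := 0) (Nat.zero_le _)
    simpa using this
  have hwR : 16 * w ≤ R := by
    refine le_trans ?_ hw4
    have : 16 ≤ w ^ 3 := by nlinarith [sq_nonneg w, mul_self_nonneg (w - 16)]
    nlinarith
  have hslack : ((n : ℝ) + 2) * E ≤ N / w := by
    have h1 : w ^ 4 * ((n : ℝ) + 2) ^ (d + 1) ≤ R := root_slack j (by
      have h2 : 2 ^ (j + 4) = 2 ^ (j + 2) * 4 := by rw [pow_add _ j 4, pow_add]; ring
      have h3 : 0 < 2 ^ (j + 2) := by positivity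
      omega)
    have h2 : 10 * w ≤ w ^ 4 := by
      have : 10 ≤ w ^ 3 := by nlinarith [sq_nonneg w, mul_self_nonneg (w - 16)]
      nlinarith
    rw [le_div_iff₀ (by linarith), hNR, hE]
    calc ((n : ℝ) + 2) * (((n : ℝ) + 2) ^ d * (10 * R)) * w
        = (10 * w) * ((n : ℝ) + 2) ^ (d + 1) * R := by rw [pow_succ]; ring
      _ ≤ w ^ 4 * ((n : ℝ) + 2) ^ (d + 1) * R := by gcongr
      _ ≤ R * R := by gcongr
      _ = R ^ 2 := by ring
  have hE0 : 0 ≤ E := by positivity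
  have hEN : E ≤ N / w := (le_mul_of_one_le_left hE0 hn2).trans hslack
  have hlenE : ∀ k < j, len k * E ≤ N / w := fun k hk => by
    have h1 : (len k : ℝ) ≤ n := by exact_mod_cast len_le_prevLen hk
    exact (mul_le_mul_of_nonneg_right (by linarith) hE0).trans hslack
  have hwinv : w⁻¹ ≤ 1 := inv_le_one_of_one_le₀ (by linarith)
  -- Here 20 = 2 + 2 · 9, from C = 2 and ε = 9/m_j.
  have hmain : ∀ f a b, Norming none f → a ≤ b → SuppIn f a b →
      |ev f y| ≤ 20 / w * ((cnt p N b : ℝ) - cnt p N a) + E := by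
    intro f a b hf hab hs
    have h1 := block_sum_estimate hp hxv hxn N hA (K := j) (fun k hk => len_le_prevLen hk)
      (ε := 9 * w⁻¹) (by positivity) (hsmall j (Nat.le_succ j)) d hf hab hs
    rw [h2d, hsqrt] at h1
    refine h1.trans (add_le_add (le_of_eq ?_) (mul_le_mul_of_nonneg_left ?_ (by positivity)))
    · rw [div_eq_mul_inv, div_eq_mul_inv]; ring
    · linarith
  have hynorm := norm_block_sum_le hp hxv (by positivity) hE0 N hmain
  have hysupp : VSupp y n₀ (p N) := VSupp.sum fun i hi => (hxv i).mono
    (by rw [← hp0]; exact hp.monotone (Nat.zero_le i)) (hp.monotone (mem_range.1 hi))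
  obtain ⟨hg, hgy⟩ := exists_lower_functional hp hxv hj le_rfl (fun i => (hx i).2.2.2.1)
    fun i => (hx i).2.2.2.2.1
  have hNw : (w / N) * (N / w) = 1 := by field_simp
  have hwN0 : 0 ≤ w / N := by positivity
  refine ⟨(w / N) • y, V.smul_mem _ (V.sum_mem fun i _ => (hx i).1), _, p N, ?_,
    hysupp.smul _, suppIn_cut n₀ (p N) _, hg.cut _ _, ?_, ?_, ?_, ?_⟩
  · rw [← hp0]; exact hp (len_pos j)
  · rw [ev_smul, ev_cut_of_vsupp hysupp, hgy, sum_congr rfl fun i _ => (hx i).2.2.2.2.2]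
    rw [sum_const, card_range, nsmul_eq_mul, mul_one, ← hw, ← hN]
    field_simp
  · rw [norm_smul, Real.norm_of_nonneg hwN0]
    calc _ ≤ (w / N) * (20 / w * N + N / w) :=
          mul_le_mul_of_nonneg_left (hynorm.trans (by linarith)) hwN0
      _ = 21 * ((w / N) * (N / w)) := by ring
      _ ≤ 23 := by rw [hNw]; norm_num
  · intro k hk g hg
    have h1 := weight_estimate (cnt_mono p N) (by positivity) hmain (hg.cut 0 (p N))
      (Nat.zero_le _) (suppIn_cut _ _ _)
    rw [ev_cut_of_vsupp (hysupp.mono (Nat.zero_le _) le_rfl)] at h1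
    have h2 := mul_le_mul_of_nonneg_left (cnt_sub_le p N 0 (p N)) (show 0 ≤ 20 / w by positivity)
    have h3 := hlenE k hk
    have hk0 : (0 : ℝ) ≤ (wt k : ℝ)⁻¹ := by positivity
    rw [ev_smul, abs_mul, abs_of_nonneg hwN0]
    calc _ ≤ (w / N) * ((20 / w * N + N / w) * (wt k : ℝ)⁻¹) := by
          refine mul_le_mul_of_nonneg_left (h1.trans ?_) hwN0
          exact mul_le_mul_of_nonneg_right (by linarith) hk0
      _ = 21 * ((w / N) * (N / w)) * (wt k : ℝ)⁻¹ := by ring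
      _ ≤ _ := by rw [hNw]; linarith
  · intro s c g hc hs hg
    -- Starting at K = j + 1 gives ε = 9/m_j², so a factor 1/m_j survives the normalization by
    -- m_j/n_j.
    have h1 := tail_estimate hp hxv hxn N hA (K := j + 1) (by positivity)
      (hsmall (j + 1) le_rfl) (a := 0) (b := p N) hc (g := fun k => cut 0 (p N) (g k))
      (fun k hk => hs k hk) (fun k hk => (hg k hk).cut _ _) (Nat.zero_le _)
      fun k _ => suppIn_cut _ _ _
    simp only [ev_cut_of_vsupp (hysupp.mono (Nat.zero_le n₀) le_rfl), ← hy] at h1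
    rw [hsqrt, wt_succ, Nat.cast_pow, ← hw] at h1
    have h2 := mul_le_mul_of_nonneg_left (cnt_sub_le p N 0 (p N))
      (show 0 ≤ 9 * (w ^ 2)⁻¹ by positivity)
    have h3 : ∑ k ∈ s, (c k : ℝ) * ev (g k) ((w / N) • y)
        = (w / N) * ∑ k ∈ s, (c k : ℝ) * ev (g k) y := by
      rw [mul_sum]; exact sum_congr rfl fun k _ => by rw [ev_smul]; ring
    rw [h3, abs_mul, abs_of_nonneg hwN0]
    calc _ ≤ (w / N) * (9 * (w ^ 2)⁻¹ * N + (9 * (w ^ 2)⁻¹ + 2 * R)) :=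
          mul_le_mul_of_nonneg_left (by linarith) hwN0
      _ ≤ (w / N) * (23 * (w ^ 2)⁻¹ * N) := by
          refine mul_le_mul_of_nonneg_left ?_ hwN0
          have h4 : 1 ≤ (N : ℝ) := by exact_mod_cast len_pos j
          have h5 : 2 * R ≤ 2 * (w ^ 2)⁻¹ * N := by
            rw [hNR]
            have : 1 ≤ (w ^ 2)⁻¹ * R := by
              rw [le_inv_mul_iff₀ (by positivity), mul_one]
              refine le_trans (pow_le_pow_right₀ (by linarith) (by norm_num)) hw4
            nlinarith
          have h6 : (w ^ 2)⁻¹ ≤ (w ^ 2)⁻¹ * N := le_mul_of_one_le_right (by positivity) h4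
          linarith
      _ = 23 * w⁻¹ := by field_simp

/-- Functionals of a weight other than `j` are small on the vector of an exact pair. -/
theorem IsExactPair.abs_ev_le {j : ℕ} {x : X} {f : Fn} {a b : ℕ} (h : IsExactPair j x f a b)
    {k : ℕ} (hk : k ≠ j) {g : Fn} (hg : Norming (some k) g) {T : ℝ} (hT : 0 < T)
    (hTj : T ≤ wt j) (hTk : T ≤ wt k) : |ev g x| ≤ 23 * T⁻¹ := by
  rcases lt_or_gt_of_ne hk with hlt | hgt
  · exact (h.small_lt k hlt g hg).trans (by gcongr)
  · have := h.small_gt {k} 1 (fun _ => g) (by simp) (by simpa using hgt) (by simpa using hg)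
    simp only [sum_singleton, Pi.one_apply, Rat.cast_one, one_mul] at this
    exact this.trans (by gcongr)

/-- This lets {j} serve as the exceptional set of the vector: weights below j sum to 2 · 23/m_K,
those above j contribute at most 23/m_K. -/
theorem IsExactPair.abs_sum_le {j : ℕ} {x : X} {f : Fn} {a b : ℕ} (h : IsExactPair j x f a b)
    {K : ℕ} (hK : K ≤ j) {s : Finset ℕ} {c : ℕ → ℚ} {g : ℕ → Fn} (hc : ∑ k ∈ s, c k ^ 2 ≤ 1)
    (hs : ∀ k ∈ s, K ≤ k ∧ k ≠ j) (hg : ∀ k ∈ s, Norming (some k) (g k)) :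
    |∑ k ∈ s, (c k : ℝ) * ev (g k) x| ≤ 69 * (wt K : ℝ)⁻¹ := by
  have hle : ∀ q : ℕ → Prop, ∀ [DecidablePred q], ∑ k ∈ s with q k, c k ^ 2 ≤ 1 := fun q _ =>
    (sum_le_sum_of_subset_of_nonneg (filter_subset _ _) fun _ _ _ => sq_nonneg _).trans hc
  rw [← sum_filter_add_sum_filter_not s (fun k => k < j)]
  have e1 : |∑ k ∈ s with k < j, (c k : ℝ) * ev (g k) x| ≤ 23 * (2 / wt K) :=
    abs_sum_mul_ev_le_of_weight (hle _) (fun k hk => (hs k (mem_filter.1 hk).1).1) (by norm_num)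
      fun k hk => h.small_lt k (mem_filter.1 hk).2 _ (hg k (mem_filter.1 hk).1)
  have e2 := h.small_gt {k ∈ s | ¬k < j} c g (hle _) (fun k hk => by
    obtain ⟨h1, h2⟩ := mem_filter.1 hk
    have := (hs k h1).2
    omega) fun k hk => hg k (mem_filter.1 hk).1
  have h5 : (wt j : ℝ)⁻¹ ≤ (wt K : ℝ)⁻¹ := inv_anti₀ (by exact_mod_cast wt_pos K)
    (by exact_mod_cast wt_strictMono.monotone hK)
  refine (abs_add_le _ _).trans ?_
  rw [div_eq_mul_inv] at e1
  linarith

/-! ### Dependent sequences. -/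

/-- A dependent sequence: exact pairs whose functionals form a special sequence. -/
structure IsDependent (q : ℕ) (x : ℕ → X) (f : ℕ → Fn) (p : ℕ → ℕ) : Prop where
  mono : StrictMono p
  pair : ∀ i, IsExactPair (code q ((List.range i).map f)) (x i) (f i) (p i) (p (i + 1))

/-- The list of earlier functionals is carried along and its code prescribes the next weight. Since
that is even, an exact pair is found in whichever subspace is due. -/
theorem exists_dependent {V₁ V₂ : Submodule ℝ X} (h₁ : Available V₁) (h₂ : Available V₂) (q : ℕ) :
    ∃ x f p, IsDependent q x f p ∧ ∀ i, x i ∈ if Even i then V₁ else V₂ := by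
  have hav : ∀ i : ℕ, Available (if Even i then V₁ else V₂) := fun i => by
    split_ifs
    exacts [h₁, h₂]
  obtain ⟨u, hu0, hu⟩ := exists_seq_of_step (S := (ℕ × List Fn) × X × Fn)
    (R := fun u v => u.1.1 < v.1.1 ∧ v.1.2 = u.1.2 ++ [v.2.2] ∧
      v.2.1 ∈ (if Even u.1.2.length then V₁ else V₂) ∧
      IsExactPair (code q u.1.2) v.2.1 v.2.2 u.1.1 v.1.1) (fun u => by
      obtain ⟨x, hx, f, b, hb, hpair⟩ :=
        (hav u.1.2.length).exists_exactPair (code_even q u.1.2) u.1.1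
      exact ⟨((b, u.1.2 ++ [f]), x, f), hb, rfl, hx, hpair⟩) ((0, []), 0, 0)
  have hlist : ∀ i, (u i).1.2 = (List.range i).map fun t => (u (t + 1)).2.2 := by
    intro i
    induction i with
    | zero => rw [hu0]; rfl
    | succ i ih => rw [(hu i).2.1, ih, List.range_succ, List.map_append]; rfl
  refine ⟨fun t => (u (t + 1)).2.1, fun t => (u (t + 1)).2.2, fun t => (u t).1.1,
    ⟨strictMono_nat_of_lt_succ fun t => (hu t).1, fun i => ?_⟩, fun i => ?_⟩
  · rw [← hlist]; exact (hu i).2.2.2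
  · have := (hu i).2.2.1
    rwa [hlist, List.length_map, List.length_range] at this

/-- Alternating sums of a sequence that is `1` on the blocks inside `[a, b)` and `0` on the blocks
outside are bounded. -/
theorem abs_alternating_sum_le {p : ℕ → ℕ} (hp : StrictMono p) {a b : ℕ} {d : ℕ → ℝ}
    (h0 : ∀ t, p (t + 1) ≤ a ∨ b ≤ p t → d t = 0)
    (h1 : ∀ t, a ≤ p t → p (t + 1) ≤ b → d t = 1) (hd : ∀ t, |d t| ≤ 23) (T : ℕ) :
    |∑ t ∈ range T, (-1) ^ t * d t| ≤ 48 := by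
  -- The three cases place p T before, inside or after the interval. Inside, c is the part from the
  -- block straddling a, and the remaining terms ±1 cancel up to one; a block straddling b adds at
  -- most 23.
  have key : (p T ≤ a ∧ ∑ t ∈ range T, (-1) ^ t * d t = 0) ∨
      (a ≤ p T ∧ p T ≤ b ∧ ∃ c : ℝ, |c| ≤ 23 ∧ (∑ t ∈ range T, (-1) ^ t * d t = c ∨
        ∑ t ∈ range T, (-1) ^ t * d t = c - (-1) ^ T)) ∨
      (b ≤ p T ∧ |∑ t ∈ range T, (-1) ^ t * d t| ≤ 48) := by
    induction T with
    | zero =>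
      rcases le_total (p 0) a with h | h
      · exact .inl ⟨h, by simp⟩
      · rcases le_total (p 0) b with h' | h'
        · exact .inr (.inl ⟨h, h', 0, by simp, .inl (by simp)⟩)
        · exact .inr (.inr ⟨h', by simp⟩)
    | succ T ih =>
      have hlt := hp (Nat.lt_succ_self T)
      have hterm : |(-1) ^ T * d T| ≤ 23 := by
        rw [abs_mul, abs_pow, abs_neg, abs_one, one_pow, one_mul]; exact hd T
      rw [sum_range_succ]
      rcases ih with ⟨hpa, hS⟩ | ⟨hpa, hpb, c, hc, hS⟩ | ⟨hpb, hS⟩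
      · rw [hS, zero_add]
        rcases le_total (p (T + 1)) a with h | h
        · exact .inl ⟨h, by rw [h0 T (.inl h), mul_zero]⟩
        · rcases le_total (p (T + 1)) b with h' | h'
          · exact .inr (.inl ⟨h, h', _, hterm, .inl rfl⟩)
          · exact .inr (.inr ⟨h', hterm.trans (by norm_num)⟩)
      · rcases le_total (p (T + 1)) b with h' | h'
        · refine .inr (.inl ⟨hpa.trans hlt.le, h', c, hc, ?_⟩)
          rw [h1 T hpa h', mul_one, pow_succ]
          rcases hS with hS | hS
          · right; rw [hS]; ring
          · left; rw [hS]; ring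
        · refine .inr (.inr ⟨h', ?_⟩)
          have hS' : |∑ t ∈ range T, (-1) ^ t * d t| ≤ 24 := by
            rcases hS with hS | hS
            · rw [hS]; linarith
            · rw [hS]
              refine (abs_sub _ _).trans ?_
              rw [abs_pow, abs_neg, abs_one, one_pow]; linarith
          exact (abs_add_le _ _).trans (by linarith)
      · refine .inr (.inr ⟨hpb.trans hlt.le, ?_⟩)
        rw [h0 T (.inr hpb), mul_zero, add_zero]; exact hS
  rcases key with ⟨-, hS⟩ | ⟨-, -, c, hc, hS | hS⟩ | ⟨-, hS⟩
  · rw [hS]; norm_num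
  · rw [hS]; linarith
  · rw [hS]
    refine (abs_sub _ _).trans ?_
    rw [abs_pow, abs_neg, abs_one, one_pow]; linarith
  · exact hS

section Dependent

variable {q : ℕ} {x : ℕ → X} {f : ℕ → Fn} {p : ℕ → ℕ}

/-- The alternating sum of a dependent sequence of length `n_q`. -/
noncomputable def altSum (q : ℕ) (x : ℕ → X) : X := ∑ i ∈ range (len q), (-1 : ℝ) ^ i • x i

theorem map_range_eq_iff {f f' : ℕ → Fn} {t i : ℕ}
    (h : (List.range t).map f' = (List.range i).map f) : t = i ∧ ∀ s < t, f' s = f s := by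
  have hti : t = i := by simpa using congrArg List.length h
  subst hti
  exact ⟨rfl, fun s hs => List.map_inj_left.1 h s (List.mem_range.2 hs)⟩

/-- Special functionals of weight `q` are bounded on the alternating sum of a dependent sequence. -/
theorem IsDependent.abs_special_le (h : IsDependent q x f p) (hq : Odd q) {g : Fn}
    (hg : Norming (some q) g) : |ev g (altSum q x)| ≤ 94 := by
  classical
  cases hg with
  | even _ hk => exact absurd hk (Nat.not_even_iff_odd.2 hq)
  | odd _ hq f' r hr hs hf' a b =>
  set N := len q with hN
  have hN0 : 0 < N := len_pos q
  have hNR : (0 : ℝ) < (N : ℝ) ^ 2 := by positivity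
  -- T is the first index where the two special sequences differ, or N.
  obtain ⟨T, hTN, hT, hT'⟩ : ∃ T ≤ N, (∀ t < T, f' t = f t) ∧ (T < N → f' T ≠ f T) := by
    by_cases hex : ∃ t, t < N ∧ f' t ≠ f t
    · refine ⟨Nat.find hex, (Nat.find_spec hex).1.le, fun t ht => ?_,
        fun _ => (Nat.find_spec hex).2⟩
      by_contra hne
      exact Nat.find_min hex ht ⟨ht.trans (Nat.find_spec hex).1, hne⟩
    · push Not at hex
      exact ⟨N, le_rfl, hex, fun h => absurd h (lt_irrefl N)⟩
  set D : ℕ → ℝ := fun t => ev (cut a b (f t)) (x t) with hD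
  have hDnorm : ∀ t, |D t| ≤ 23 := fun t =>
    (abs_ev_le_norm ((h.pair t).norming.of_weight.cut a b) _).trans (h.pair t).norm_le
  have hhead : |∑ t ∈ range T, (-1) ^ t * D t| ≤ 48 := by
    refine abs_alternating_sum_le (a := a) (b := b) h.mono (fun t ht => ?_) (fun t ha hb => ?_) hDnorm T
    · refine ev_eq_zero (suppIn_cut a b _) (h.pair t).vsupp ?_
      tauto
    · have : cut a b (f t) = f t := ((h.pair t).suppIn.mono ha hb).cut_eq
      rw [hD]; simp only [this]; exact (h.pair t).ev_eq
  -- From T on, equal codes force t = i and equal predecessors, hence t = i = T; every other pair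
  -- has distinct weights and contributes at most 23/N². The total is 48 + 23 + 23 = 94.
  have hterm : ∀ t, t < N → T ≤ t → ∀ i, |(-1) ^ i * ev (cut a b (f' t)) (x i)|
      ≤ 23 * ((N : ℝ) ^ 2)⁻¹ + if t = T then (if i = T then 23 else 0) else 0 := by
    intro t htN hTt i
    rw [abs_mul, abs_pow, abs_neg, abs_one, one_pow, one_mul]
    have hpos : (0 : ℝ) ≤ 23 * ((N : ℝ) ^ 2)⁻¹ := by positivity
    have hind : (0 : ℝ) ≤ if t = T then (if i = T then (23 : ℝ) else 0) else 0 := by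
      split_ifs <;> norm_num
    by_cases hcode : code q ((List.range t).map f') = code q ((List.range i).map f)
    · obtain ⟨hti, hpre⟩ := map_range_eq_iff (code_injective q hcode)
      have htT : t = T := by
        by_contra hne
        have hlt : T < t := lt_of_le_of_ne hTt (Ne.symm hne)
        exact hT' (hlt.trans htN) (hpre T hlt)
      have := (abs_ev_le_norm ((hf' t).of_weight.cut a b) (x i)).trans (h.pair i).norm_le
      rw [if_pos htT, if_pos (hti.symm.trans htT)]
      linarith
    · have := (h.pair i).abs_ev_le hcode ((hf' t).cut a b) hNR
        (by exact_mod_cast len_sq_le_wt_code q _) (by exact_mod_cast len_sq_le_wt_code q _)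
      linarith
  have hval : ∀ t ∈ range N, ev (cut a b (f' t)) (altSum q x)
      = ∑ i ∈ range N, (-1) ^ i * ev (cut a b (f' t)) (x i) := fun t _ => by
    rw [altSum, ev_sum]; exact sum_congr rfl fun i _ => by rw [ev_smul]
  have hsmall : ∀ t ∈ range N, |ev (cut a b (f' t)) (altSum q x)
      - if t < T then (-1) ^ t * D t else 0| ≤ ∑ i ∈ range N, (23 * ((N : ℝ) ^ 2)⁻¹ +
        if t = T then (if i = T then 23 else 0) else 0) := by
    intro t ht
    rw [hval t ht]
    by_cases htT : t < T
    · rw [if_pos htT, hT t htT, sum_eq_single_of_mem t ht fun i _ hi => ?_, sub_self, abs_zero]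
      · exact sum_nonneg fun i _ => by positivity
      · rw [ev_eq_zero ((h.pair t).suppIn.cut a b) (h.pair i).vsupp, mul_zero]
        rcases lt_or_gt_of_ne hi with hlt | hlt
        · exact .inr (h.mono.monotone hlt)
        · exact .inl (h.mono.monotone hlt)
    · rw [if_neg htT, sub_zero]
      exact (abs_sum_le_sum_abs _ _).trans
        (sum_le_sum fun i _ => hterm t (mem_range.1 ht) (not_lt.1 htT) i)
  have htotal : |∑ t ∈ range N, ev (cut a b (f' t)) (altSum q x)| ≤ 94 := by
    have e1 : ∑ t ∈ range N, (if t < T then (-1) ^ t * D t else 0)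
        = ∑ t ∈ range T, (-1) ^ t * D t := by
      rw [← sum_filter]
      refine sum_congr ?_ fun _ _ => rfl
      ext t; simp only [mem_filter, mem_range]; omega
    have e2 : |∑ t ∈ range N, (ev (cut a b (f' t)) (altSum q x)
        - if t < T then (-1) ^ t * D t else 0)| ≤ 46 := by
      refine ((abs_sum_le_sum_abs _ _).trans (sum_le_sum hsmall)).trans ?_
      simp only [sum_add_distrib, sum_const, card_range, nsmul_eq_mul]
      have e3 : ∑ t ∈ range N, ∑ i ∈ range N,
          (if t = T then (if i = T then (23 : ℝ) else 0) else 0) ≤ 23 := by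
        have : ∀ t ∈ range N, ∑ i ∈ range N, (if t = T then (if i = T then (23 : ℝ) else 0) else 0)
            ≤ if t = T then 23 else 0 := fun t _ => by
          split_ifs
          · rw [sum_ite_eq']; split_ifs <;> norm_num
          · simp
        refine (sum_le_sum this).trans ?_
        rw [sum_ite_eq']; split_ifs <;> norm_num
      have e4 : (N : ℝ) * (N * (23 * ((N : ℝ) ^ 2)⁻¹)) = 23 := by field_simp
      linarith
    rw [sum_sub_distrib, e1] at e2
    have := abs_sub_abs_le_abs_sub (∑ t ∈ range N, ev (cut a b (f' t)) (altSum q x))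
      (∑ t ∈ range T, (-1) ^ t * D t)
    linarith
  have hw : ((wt q : ℝ))⁻¹ ≤ 1 := inv_le_one_of_one_le₀ (by exact_mod_cast wt_pos q)
  rw [smul_ev, sum_ev, abs_mul]
  push_cast
  rw [abs_of_nonneg (by positivity)]
  exact (mul_le_of_le_one_left (abs_nonneg _) hw).trans htotal

/-- The alternating sum of a dependent sequence has small norm. -/
theorem IsDependent.norm_altSum_le (h : IsDependent q x f p) (hq : Odd q) :
    ‖altSum q x‖ ≤ 162 * len q / wt q ^ 2 := by
  set N := len q with hN
  set R := (root q : ℝ) with hR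
  set w := (wt q : ℝ) with hw
  set n := prevLen q with hn
  -- At this depth 2^d = m_q², the gain needed against the lower bound n_q/m_q.
  set d := 2 ^ (q + 3) with hd
  have hw16 : (16 : ℝ) ≤ w := by rw [hw]; exact_mod_cast sixteen_le_wt q
  have hNR : (N : ℝ) = R ^ 2 := by rw [hN, hR]; unfold len; push_cast; rfl
  have hR0 : (0 : ℝ) < R := by rw [hR]; exact_mod_cast root_pos q
  have hsqrt : √(N : ℝ) = R := by rw [hNR]; exact Real.sqrt_sq hR0.le
  have h2d : (2 : ℝ) ^ d = w ^ 2 := by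
    rw [hd, show q + 3 = (q + 1) + 2 from rfl, wt_eq_two_pow, wt_succ, Nat.cast_pow]
  have hwR : w ≤ R := by rw [hw, hR]; exact_mod_cast wt_le_root q
  set z : ℕ → X := fun i => (-1 : ℝ) ^ i • x i with hz
  have hzv : ∀ i, VSupp (z i) (p i) (p (i + 1)) := fun i => (h.pair i).vsupp.smul _
  have hzn : ∀ i, ‖z i‖ ≤ 23 := fun i => by
    rw [hz, norm_smul, norm_pow, norm_neg, norm_one, one_pow, one_mul]
    exact (h.pair i).norm_le
  set A : ℕ → Set ℕ := fun i => {code q ((List.range i).map f)} with hA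
  have hAd : ∀ i i', i ≠ i' → Disjoint (A i) (A i') := fun i i' hne =>
    Set.disjoint_singleton.2 fun heq => hne (map_range_eq_iff (code_injective q heq)).1
  have hwinv : (wt (q + 1) : ℝ)⁻¹ = (w ^ 2)⁻¹ := by rw [wt_succ, Nat.cast_pow]
  set ε := 69 * (w ^ 2)⁻¹ with hε
  have hε0 : 0 ≤ ε := by positivity
  have hε1 : ε ≤ 1 := by
    rw [hε, mul_inv_le_iff₀ (by positivity)]; nlinarith
  have hsmall : ∀ i, ∀ (s : Finset ℕ) (c : ℕ → ℚ) (g : ℕ → Fn), ∑ k ∈ s, c k ^ 2 ≤ 1 →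
      (∀ k ∈ s, q + 1 ≤ k ∧ k ∉ A i) → (∀ k ∈ s, Norming (some k) (g k)) →
      |∑ k ∈ s, (c k : ℝ) * ev (g k) (z i)| ≤ ε := by
    intro i s c g hc hs hg
    have h1 := (h.pair i).abs_sum_le (lt_code q _) hc hs hg
    have h2 : ∑ k ∈ s, (c k : ℝ) * ev (g k) (z i)
        = (-1) ^ i * ∑ k ∈ s, (c k : ℝ) * ev (g k) (x i) := by
      rw [mul_sum]; exact sum_congr rfl fun k _ => by rw [hz, ev_smul]; ring
    rw [h2, abs_mul, abs_pow, abs_neg, abs_one, one_pow, one_mul, hε, ← hwinv]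
    exact h1
  -- Weight q itself is split off and enters only through the constant 94; the weights above q give
  -- ε = 69/m_{q+1} = 69/m_q². In the end 162 = 23 + 2 · 69 + 1.
  have hmain := tree_estimate (y := altSum q x) (cnt_mono p N) (K := q) (n := n)
    (fun k hk => len_le_prevLen hk) (C := 23) (ε := ε) (B := ε + 23 * R + 94) (by norm_num) hε0
    (fun m => (abs_coord_sum_le h.mono hzv hzn N m).trans (by linarith))
    (fun f a b hf hab hs => base_estimate h.mono hzv hzn N hf hab hs)
    (fun s c g a b hc hK hg hab hs => by
      have hle : ∀ P : ℕ → Prop, ∀ [DecidablePred P], ∑ k ∈ s with P k, c k ^ 2 ≤ 1 :=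
        fun P _ => (sum_le_sum_of_subset_of_nonneg (filter_subset _ _)
          fun _ _ _ => sq_nonneg _).trans hc
      rw [← sum_filter_add_sum_filter_not s (fun k => k = q)]
      have e1 : |∑ k ∈ s with k = q, (c k : ℝ) * ev (g k) (altSum q x)| ≤ 94 := by
        rw [filter_eq']
        split_ifs with hqs
        · rw [sum_singleton, abs_mul]
          have h1 := abs_coef_le_one hc hqs
          have h2 := h.abs_special_le hq (hg q hqs)
          have h3 := abs_nonneg (ev (g q) (altSum q x))
          nlinarith
        · simp
      have e2 := tail_estimate h.mono hzv hzn N hAd hε0 hsmall (hle fun k => ¬k = q)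
        (fun k hk => by
          obtain ⟨h1, h2⟩ := mem_filter.1 hk
          have := hK k h1
          omega) (fun k hk => hg k (mem_filter.1 hk).1) hab fun k hk => hs k (mem_filter.1 hk).1
      rw [hsqrt] at e2
      refine (abs_add_le _ _).trans ((add_le_add e1 e2).trans (le_of_eq ?_))
      ring) d
  rw [h2d] at hmain
  refine (norm_block_sum_le h.mono hzv (by positivity) (by positivity) N hmain).trans ?_
  have h1 : w ^ 4 * ((n : ℝ) + 2) ^ d ≤ R := root_slack q (Nat.pow_le_pow_right (by norm_num)
    (by omega))
  have h2 : ((n : ℝ) + 2) ^ d * (2 * 23 + 2 * ε + (ε + 23 * R + 94)) ≤ N / w ^ 2 := by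
    rw [le_div_iff₀ (by positivity), hNR]
    calc ((n : ℝ) + 2) ^ d * (2 * 23 + 2 * ε + (ε + 23 * R + 94)) * w ^ 2
        ≤ ((n : ℝ) + 2) ^ d * (w ^ 2 * R) * w ^ 2 := by
          gcongr
          nlinarith [mul_nonneg (show (0 : ℝ) ≤ w ^ 2 - 256 by nlinarith) hR0.le]
      _ = w ^ 4 * ((n : ℝ) + 2) ^ d * R := by ring
      _ ≤ R * R := by gcongr
      _ = R ^ 2 := by ring
  have h3 : (23 / w ^ 2 + 2 * ε) * N + N / w ^ 2 = 162 * N / w ^ 2 := by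
    rw [hε, div_eq_mul_inv, div_eq_mul_inv, div_eq_mul_inv]; ring
  linarith

/-- The sum of a dependent sequence has large norm. -/
theorem IsDependent.le_norm_sum (h : IsDependent q x f p) (hq : Odd q) :
    (len q : ℝ) / wt q ≤ ‖∑ i ∈ range (len q), x i‖ := by
  have hg := Norming.odd q hq f p h.mono.monotone (fun t => (h.pair t).suppIn)
    (fun t => (h.pair t).norming) 0 (p (len q))
  refine le_trans (le_of_eq ?_) ((le_abs_self _).trans (abs_ev_le_norm hg.of_weight _))
  rw [smul_ev, sum_ev, sum_congr rfl fun t ht => ?_, sum_const, card_range, nsmul_eq_mul, mul_one]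
  · push_cast; rw [div_eq_mul_inv, mul_comm]
  · have hcut : cut 0 (p (len q)) (f t) = f t := ((h.pair t).suppIn.mono (Nat.zero_le _)
      (h.mono.monotone (mem_range.1 ht))).cut_eq
    rw [hcut, ev_sum, sum_eq_single_of_mem t ht fun i _ hi => ?_, (h.pair t).ev_eq]
    refine ev_eq_zero (h.pair t).suppIn (h.pair i).vsupp ?_
    rcases lt_or_gt_of_ne hi with hlt | hlt
    · exact .inr (h.mono.monotone hlt)
    · exact .inl (h.mono.monotone hlt)

end Dependent

/-! ### Hereditary indecomposability. -/

/-- Two available subspaces are at angle zero. -/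
theorem Available.exists_close {V₁ V₂ : Submodule ℝ X} (h₁ : Available V₁) (h₂ : Available V₂)
    (M : ℝ) : ∃ y ∈ V₁, ∃ z ∈ V₂, M * ‖y - z‖ < ‖y + z‖ := by
  obtain ⟨l, hl⟩ := exists_nat_gt (162 * |M|)
  set q := 2 * l + 1 with hqdef
  have hq : Odd q := odd_two_mul_add_one l
  obtain ⟨x, f, p, hdep, hx⟩ := exists_dependent h₁ h₂ q
  refine ⟨∑ i ∈ range (len q) with Even i, x i, V₁.sum_mem fun i hi => ?_,
    ∑ i ∈ range (len q) with ¬Even i, x i, V₂.sum_mem fun i hi => ?_, ?_⟩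
  · have := hx i; rwa [if_pos (mem_filter.1 hi).2] at this
  · have := hx i; rwa [if_neg (mem_filter.1 hi).2] at this
  · have hsub : ∑ i ∈ range (len q) with Even i, x i - ∑ i ∈ range (len q) with ¬Even i, x i
        = altSum q x := by
      rw [altSum, ← sum_filter_add_sum_filter_not (range (len q)) (fun i => Even i)
        fun i => (-1 : ℝ) ^ i • x i, sub_eq_add_neg, ← sum_neg_distrib]
      congr 1
      · refine sum_congr rfl fun i hi => ?_
        rw [(mem_filter.1 hi).2.neg_one_pow, one_smul]
      · refine sum_congr rfl fun i hi => ?_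
        rw [(Nat.not_even_iff_odd.1 (mem_filter.1 hi).2).neg_one_pow, neg_one_smul]
    rw [hsub, sum_filter_add_sum_filter_not]
    have hw : (0 : ℝ) < wt q := by exact_mod_cast wt_pos q
    have hlen : (0 : ℝ) < len q := by exact_mod_cast len_pos q
    have hlw : (l : ℝ) ≤ wt q := by
      exact_mod_cast (show l ≤ q by omega).trans (le_wt q)
    calc M * ‖altSum q x‖ ≤ |M| * (162 * len q / wt q ^ 2) :=
          mul_le_mul (le_abs_self M) (hdep.norm_altSum_le hq) (norm_nonneg _) (abs_nonneg M)
      _ = (162 * |M|) / wt q * (len q / wt q) := by field_simp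
      _ < 1 * (len q / wt q) := by
          refine mul_lt_mul_of_pos_right ?_ (by positivity)
          rw [div_lt_one hw]; linarith
      _ ≤ _ := by rw [one_mul]; exact hdep.le_norm_sum hq

/-- Every infinite-dimensional subspace is close to an available one. -/
theorem exists_available {P : Submodule ℝ X} (hP : ¬ FiniteDimensional ℝ P) {η : ℝ} (hη : 0 < η) :
    ∃ V : Submodule ℝ X, Available V ∧ ∀ x ∈ V, ∃ x' ∈ P, ‖x - x'‖ ≤ η * ‖x‖ := by
  -- The map to the first n coordinates cannot be injective on P.
  have hfar : ∀ n, ∃ v ∈ P, ‖v‖ = 1 ∧ ∀ m < n, coord v m = 0 := by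
    intro n
    let L : P →ₗ[ℝ] (Fin n → ℝ) := LinearMap.pi fun m => (evL (Finsupp.single m 1)).comp P.subtype
    have hL : ∀ v : P, ∀ m : Fin n, L v m = coord v m := fun v m => (coord_eq_ev _ _).symm
    have hker : ¬ Function.Injective L := fun hinj => hP (FiniteDimensional.of_injective L hinj)
    rw [← LinearMap.ker_eq_bot, Submodule.eq_bot_iff] at hker
    push Not at hker
    obtain ⟨v, hv, hv0⟩ := hker
    have hne : ‖(v : X)‖ ≠ 0 := norm_ne_zero_iff.2 fun h => hv0 (Subtype.ext h)
    refine ⟨‖(v : X)‖⁻¹ • (v : X), P.smul_mem _ v.2, ?_, fun m hm => ?_⟩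
    · rw [norm_smul, norm_inv, norm_norm, inv_mul_cancel₀ hne]
    · have := congrFun (LinearMap.mem_ker.1 hv) ⟨m, hm⟩
      rw [hL] at this
      rw [coord_smul, this]; simp
  have hstep : ∀ n, ∀ ε : ℝ, 0 < ε → ∃ u : X, ∃ v ∈ P, ∃ b, n < b ∧ ‖u‖ = 1 ∧ VSupp u n b ∧
      ‖u - v‖ ≤ ε := by
    intro n ε hε
    obtain ⟨v, hv, hvn, hv0⟩ := hfar n
    obtain ⟨b, hb, hvb⟩ := exists_norm_sub_trunc_le v
      (show 0 < min (ε / 2) (1 / 2) by positivity) n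
    set u := trunc 0 b v with hu
    have h1 : ‖v - u‖ ≤ ε / 2 := hvb.trans (min_le_left _ _)
    have h2 : ‖v - u‖ ≤ 1 / 2 := hvb.trans (min_le_right _ _)
    have h3 : 1 / 2 ≤ ‖u‖ := by
      have := norm_sub_norm_le v u
      linarith
    have hupos : 0 < ‖u‖ := by linarith
    have hsupp : VSupp u n b := fun m hm => by
      have h4 := (vsupp_trunc 0 b v m hm).2
      refine ⟨?_, h4⟩
      by_contra hlt
      rw [hu, coord_trunc, if_pos ⟨Nat.zero_le _, h4⟩, hv0 m (not_le.1 hlt)] at hm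
      exact hm rfl
    refine ⟨‖u‖⁻¹ • u, ‖u‖⁻¹ • v, P.smul_mem _ hv, b, hb, ?_, hsupp.smul _, ?_⟩
    · rw [norm_smul, norm_inv, norm_norm, inv_mul_cancel₀ hupos.ne']
    · rw [← smul_sub, norm_smul, norm_inv, norm_norm, norm_sub_rev, inv_mul_le_iff₀ hupos]
      nlinarith
  obtain ⟨s, -, hs⟩ := exists_seq_of_step (S := (ℕ × ℕ) × X × X)
    (R := fun s t => t.1.1 = s.1.1 + 1 ∧ s.1.2 < t.1.2 ∧ ‖t.2.1‖ = 1 ∧ VSupp t.2.1 s.1.2 t.1.2 ∧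
      t.2.2 ∈ P ∧ ‖t.2.1 - t.2.2‖ ≤ η / 2 * (1 / 2) ^ s.1.1) (fun s => by
      obtain ⟨u, v, hv, b, hb, hu, hsupp, huv⟩ :=
        hstep s.1.2 (η / 2 * (1 / 2) ^ s.1.1) (by positivity)
      exact ⟨((s.1.1 + 1, b), u, v), rfl, hb, hu, hsupp, hv, huv⟩) ((0, 0), 0, 0)
  have hidx : ∀ t, t ≤ (s t).1.1 := fun t => by
    induction t with
    | zero => exact Nat.zero_le _
    | succ t ih => rw [(hs t).1]; omega
  have hp : StrictMono fun t => (s t).1.2 := strictMono_nat_of_lt_succ fun t => (hs t).2.1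
  set u : ℕ → X := fun t => (s (t + 1)).2.1 with hu
  set v : ℕ → X := fun t => (s (t + 1)).2.2 with hv
  have huv : ∀ t, ‖u t - v t‖ ≤ η / 2 * (1 / 2) ^ t := fun t =>
    (hs t).2.2.2.2.2.trans (mul_le_mul_of_nonneg_left
      (pow_le_pow_of_le_one (by norm_num) (by norm_num) (hidx t)) (by positivity))
  refine ⟨Submodule.span ℝ (Set.range u), fun n => ?_, fun x hx => ?_⟩
  · exact ⟨u n, Submodule.subset_span ⟨n, rfl⟩, (s (n + 1)).1.2,
      (hp.le_apply (x := n)).trans_lt (hs n).2.1, (hs n).2.2.1,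
      (hs n).2.2.2.1.mono hp.le_apply le_rfl⟩
  · obtain ⟨c, rfl⟩ := Finsupp.mem_span_range_iff_exists_finsupp.1 hx
    set x := c.sum fun i a => a • u i with hxdef
    -- Interval projections are contractions and the blocks are normalized, so the errors add up to
    -- at most η times the norm.
    have hcoef : ∀ i, |c i| ≤ ‖x‖ := by
      intro i
      by_cases hi : i ∈ c.support
      · have htr : trunc (s i).1.2 (s (i + 1)).1.2 x = c i • u i := by
          refine ext_coord fun m => ?_
          rw [coord_trunc, hxdef, Finsupp.sum, coord_sum]
          split_ifs with hm
          · refine sum_eq_single_of_mem i hi fun j _ hj => ?_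
            rw [coord_smul, (hs j).2.2.2.1.coord_eq_zero, mul_zero]
            rcases lt_or_gt_of_ne hj with h | h
            · have := hp.monotone (show j + 1 ≤ i from h); omega
            · have := hp.monotone (show i + 1 ≤ j from h); omega
          · rw [coord_smul, (hs i).2.2.2.1.coord_eq_zero (by omega), mul_zero]
        have h1 := norm_trunc_le (s i).1.2 (s (i + 1)).1.2 x
        rwa [htr, norm_smul, (hs i).2.2.1, mul_one, Real.norm_eq_abs] at h1
      · rw [Finsupp.notMem_support_iff.1 hi]; simp
    refine ⟨c.sum fun i a => a • v i, P.sum_mem fun i _ => P.smul_mem _ (hs i).2.2.2.2.1, ?_⟩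
    rw [hxdef, Finsupp.sum, Finsupp.sum, ← sum_sub_distrib]
    calc _ ≤ ∑ i ∈ c.support, ‖x‖ * (η / 2 * (1 / 2) ^ i) := by
          refine (norm_sum_le _ _).trans (sum_le_sum fun i _ => ?_)
          rw [← smul_sub, norm_smul, Real.norm_eq_abs]
          exact mul_le_mul (hcoef i) (huv i) (norm_nonneg _) (norm_nonneg _)
      _ = ‖x‖ * (η / 2) * ∑ i ∈ c.support, (1 / 2) ^ i := by
          rw [mul_sum]; exact sum_congr rfl fun i _ => by ring
      _ ≤ ‖x‖ * (η / 2) * 2 := by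
          refine mul_le_mul_of_nonneg_left ?_ (by positivity)
          have := summable_geometric_two.sum_le_tsum c.support fun _ _ => by positivity
          rwa [tsum_geometric_two] at this
      _ = η * ‖x‖ := by ring

/-- Any two infinite-dimensional subspaces are at angle zero. -/
theorem exists_close {P Q : Submodule ℝ X} (hP : ¬ FiniteDimensional ℝ P)
    (hQ : ¬ FiniteDimensional ℝ Q) {M : ℝ} (hM : 1 ≤ M) :
    ∃ y ∈ P, ∃ z ∈ Q, M * ‖y - z‖ < ‖y + z‖ := by
  have hM0 : 0 < M := by linarith
  -- With 8M in all three places, passing to P and Q leaves M‖y' - z'‖ < 3S/8 against ‖y' + z'‖ ≥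
  -- 3S/4.
  obtain ⟨V₁, h₁, hV₁⟩ := exists_available hP (show 0 < 1 / (8 * M) by positivity)
  obtain ⟨V₂, h₂, hV₂⟩ := exists_available hQ (show 0 < 1 / (8 * M) by positivity)
  obtain ⟨y, hy, z, hz, hyz⟩ := h₁.exists_close h₂ (8 * M)
  obtain ⟨y', hy', hyy⟩ := hV₁ y hy
  obtain ⟨z', hz', hzz⟩ := hV₂ z hz
  set S := ‖y + z‖ with hS
  have hS0 : 0 < S := (by positivity : 0 ≤ 8 * M * ‖y - z‖).trans_lt hyz
  have hsub : ‖y - z‖ ≤ S := by nlinarith [norm_nonneg (y - z)]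
  have hyS : ‖y‖ ≤ S := by
    have h1 : (2 : ℝ) • y = (y + z) + (y - z) := by rw [two_smul]; abel
    have h2 := norm_add_le (y + z) (y - z)
    rw [← h1, norm_smul, Real.norm_of_nonneg (by norm_num)] at h2
    linarith
  have hzS : ‖z‖ ≤ S := by
    have h1 : (2 : ℝ) • z = (y + z) - (y - z) := by rw [two_smul]; abel
    have h2 := norm_sub_le (y + z) (y - z)
    rw [← h1, norm_smul, Real.norm_of_nonneg (by norm_num)] at h2
    linarith
  have hηM : M * (1 / (8 * M) * S) = S / 8 := by field_simp
  have hyM : M * ‖y - y'‖ ≤ S / 8 := by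
    rw [← hηM]
    exact mul_le_mul_of_nonneg_left (hyy.trans (mul_le_mul_of_nonneg_left hyS (by positivity)))
      hM0.le
  have hzM : M * ‖z - z'‖ ≤ S / 8 := by
    rw [← hηM]
    exact mul_le_mul_of_nonneg_left (hzz.trans (mul_le_mul_of_nonneg_left hzS (by positivity)))
      hM0.le
  have e1 : ‖y' - z'‖ ≤ ‖y - z‖ + ‖y - y'‖ + ‖z - z'‖ := by
    have h1 : y' - z' = (y - z) - (y - y') + (z - z') := by abel
    rw [h1]
    exact (norm_add_le _ _).trans (add_le_add (norm_sub_le _ _) le_rfl)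
  have e2 : S ≤ ‖y' + z'‖ + ‖y - y'‖ + ‖z - z'‖ := by
    have h1 : y + z = (y' + z') + (y - y') + (z - z') := by abel
    rw [hS, h1]
    exact (norm_add_le _ _).trans (add_le_add (norm_add_le _ _) le_rfl)
  have e3 : ‖y - y'‖ ≤ M * ‖y - y'‖ := le_mul_of_one_le_left (norm_nonneg _) hM
  have e4 : ‖z - z'‖ ≤ M * ‖z - z'‖ := le_mul_of_one_le_left (norm_nonneg _) hM
  have e5 := mul_le_mul_of_nonneg_left e1 hM0.le
  exact ⟨y', hy', z', hz', by linarith⟩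

/-- For a topological direct sum the reflection T = 2L - id is bounded and sends y - z to y + z,
which angle zero forbids. -/
theorem isHereditarilyIndecomposable : SpreadingModels.IsHereditarilyIndecomposable X := by
  refine ⟨not_finiteDimensional, ?_⟩
  rintro Y - ⟨P, Q, hP, hQ, hPQ⟩
  have hmap : ∀ W : Submodule ℝ Y, ¬ FiniteDimensional ℝ W →
      ¬ FiniteDimensional ℝ (W.map Y.subtype) := fun W hW hfin =>
    hW (Y.equivSubtypeMap W).symm.finiteDimensional
  set L := Submodule.projectionL P Q hPQ with hL
  set T : Y →L[ℝ] Y := L + L - ContinuousLinearMap.id ℝ Y with hT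
  obtain ⟨y, hy, z, hz, hyz⟩ := exists_close (hmap P hP) (hmap Q hQ) (le_max_left 1 ‖T‖)
  obtain ⟨y, hyP, rfl⟩ := hy
  obtain ⟨z, hzQ, rfl⟩ := hz
  have hLy : L y = y := Submodule.projectionL_apply_left hPQ ⟨y, hyP⟩
  have hLz : L z = 0 := Submodule.projectionL_apply_right hPQ ⟨z, hzQ⟩
  have hTyz : T (y - z) = y + z := by
    simp only [hT, _root_.sub_apply, _root_.add_apply, ContinuousLinearMap.id_apply, map_sub, hLy,
      hLz]
    abel
  have h1 := T.le_opNorm (y - z)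
  rw [hTyz] at h1
  have h2 : ‖y + z‖ ≤ max 1 ‖T‖ * ‖y - z‖ :=
    h1.trans (mul_le_mul_of_nonneg_right (le_max_right _ _) (norm_nonneg _))
  exact absurd hyz (not_lt.2 h2)

end HISpace

theorem mainTheorem2 :
    ∃ (X : Type) (_ : NormedAddCommGroup X) (_ : NormedSpace ℝ X) (_ : CompleteSpace X),
      SpreadingModels.IsReflexiveSpace X ∧
      SpreadingModels.IsHereditarilyIndecomposable X ∧
      (∀ p : ℝ, 1 ≤ p → ¬ SpreadingModels.AdmitsLpSpreadingModel X p) ∧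
      ¬ SpreadingModels.AdmitsC0SpreadingModel X :=
  ⟨HISpace.X, inferInstance, inferInstance, inferInstance, HISpace.isReflexiveSpace,
    HISpace.isHereditarilyIndecomposable, fun _ hp => HISpace.not_admitsLp hp,
    HISpace.not_admitsC0⟩
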